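/- **Setting.** Let $\mathbb X\subseteq\mathbb R^d$ be closed and convex, let $\xi$ be random with law $\Xi$, and consider $$\min_{x\in\mathbb X}\ \varphi(x)=f(x)+r(x),\qquad f(x)=\mathbb E_{\xi\sim\Xi}[f(x,\xi)],$$ where $f(\cdot,\xi),r:\mathbb X\to\mathbb R$ are lower semicontinuous, $f(x,\cdot)$ is integrable for each $x\in\mathbb X$, and the minimum $\varphi^*$ is attained. A function $\psi$ is $\rho$-weakly convex on $\mathbb X$ if $\theta=\psi+\frac{\rho}{2}\|\cdot\|^2$ is convex on $\mathbb X$; then $\partial\psi(x)=\partial\theta(x)-\rho x$, where $\partial\theta(x)=\{v:\theta(y)\ge\theta(x)+\langle v,y-x\rangle\ \forall y\in\mathbb X\}$. For $\lambda>0$ let $\varphi_\lambda(x)=\min_{y\in\mathbb X}\{\varphi(y)+\frac1{2\lambda}\|y-x\|^2\}$, and let $\mathcal N_{\mathbb X}(x)=\{v:\langle v,y-x\rangle\le0\ \forall y\in\mathbb X\}$. Let $g(x,\xi)\in\partial f(x,\xi)$ ($x\in\mathbb X$) be a jointly measurable choice of stochastic subgradients. The method Sto-SubGrad starts at a point $x^0\in\mathbb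 X$, draws independent samples $\xi_0,\xi_1,\dots$ from $\Xi$, and takes $$x^{k+1}\in\arg\min_{x\in\mathbb X}\Big\{\langle g(x^k,\xi_k),x\rangle+r(x)+\tfrac1{2\alpha_k}\|x-x^k\|^2\Big\},$$ where $x^k$ is measurable with respect to $\xi_0,\dots,\xi_{k-1}$. **Theorem (Further convergence analysis of Sto-SubGrad).** Suppose that $r$ is $\eta$-weakly convex with $\eta\ge0$, that $f(\cdot,\xi)$ is $\rho(\xi)$-weakly convex with $\rho(\cdot)$ integrable and $\rho\ge\mathbb E[\rho(\xi)]\ge0$, that $\lambda>0$ and $\lambda(\rho+2\eta)<1$, and that one of the following holds: * (B$'_{D\text{-}D}$) $\|g(x,\xi)\|\le L_f(\xi)$ for all $x\in\mathbb X$, with $\mathbb E[L_f(\xi)^2]<\infty$; * (B$'_3$) there are $c_3,c_4\ge0$ such that for each $x\in\mathbb X$ there is $h\in\partial r(x)$ with $\mathbb E\|g(x,\xi)+h\|^2\le c_3[\varphi_\lambda(x)-\varphi^*]+c_4$; * (B$'_4$) there are $c_5,c_6\ge0$ such that for each $x\in\mathbb X$ there is $h\in\partial r(x)$ with $\mathbb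 E\|g(x,\xi)+h\|^2\le c_5\|\nabla\varphi_\lambda(x)\|^2+c_6$. Suppose that $\alpha_k>0$, $\sum_k\alpha_k=\infty$ and $\sum_k\alpha_k^2<\infty$. Suppose moreover that $\varphi$ has the global KL property with exponent $1/2$ and parameter $\kappa>0$: $\varphi(x)-\varphi^*\le\kappa\,\mathrm{dist}^2(0,\partial\varphi(x)+\mathcal N_{\mathbb X}(x))$ for all $x\in\mathbb X$ (with $\mathrm{dist}(0,\emptyset)=\infty$). Then: 1. $\lim_{k\to\infty}\varphi_\lambda(x^k)=\varphi^*$ almost surely. 2. If $\alpha_k=\Delta_5/k$ for all sufficiently large $k$, where $\Delta_5>\dfrac{4(\kappa+\lambda/2)}{1-\lambda(\rho+2\eta)}$, and $\alpha_k\eta<1$ for all $k$, then $\varphi_\lambda(x^k)-\varphi^*$ is integrable for every $k$ and $\mathbb E[\varphi_\lambda(x^k)-\varphi^*]=O(1/k)$. -/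

import Mathlib

open MeasureTheory ProbabilityTheory Filter Topology
open scoped Pointwise ENNReal RealInnerProductSpace

noncomputable section

namespace StoSubGrad

/-- `φ` is `ρ`-weakly convex on `X`: the function `φ + (ρ/2)‖·‖²` is convex on `X`. -/
def WeaklyConvexOn {d : ℕ} (X : Set (EuclideanSpace ℝ (Fin d))) (ρ : ℝ)
    (φ : EuclideanSpace ℝ (Fin d) → ℝ) : Prop :=
  ConvexOn ℝ X (fun x => φ x + ρ / 2 * ‖x‖ ^ 2)

/-- The convex subdifferential at `x` of a function `θ` on `X`. -/
def convexSubdiff {d : ℕ} (X : Set (EuclideanSpace ℝ (Fin d)))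
    (θ : EuclideanSpace ℝ (Fin d) → ℝ) (x : EuclideanSpace ℝ (Fin d)) :
    Set (EuclideanSpace ℝ (Fin d)) :=
  {v | ∀ y ∈ X, θ x + ⟪v, y - x⟫ ≤ θ y}

/-- The subdifferential at `x` of a `ρ`-weakly convex function `φ` on `X`:
`∂φ(x) = ∂θ(x) - ρ x` where `θ = φ + (ρ/2)‖·‖²`. -/
def subdiff {d : ℕ} (X : Set (EuclideanSpace ℝ (Fin d))) (ρ : ℝ)
    (φ : EuclideanSpace ℝ (Fin d) → ℝ) (x : EuclideanSpace ℝ (Fin d)) :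
    Set (EuclideanSpace ℝ (Fin d)) :=
  {v | v + ρ • x ∈ convexSubdiff X (fun z => φ z + ρ / 2 * ‖z‖ ^ 2) x}

/-- The normal cone of `X` at `x`. -/
def normalCone {d : ℕ} (X : Set (EuclideanSpace ℝ (Fin d))) (x : EuclideanSpace ℝ (Fin d)) :
    Set (EuclideanSpace ℝ (Fin d)) :=
  {v | ∀ y ∈ X, ⟪v, y - x⟫ ≤ 0}

/-- The set of optimal solutions of `min_{x ∈ X} φ(x)`. -/
def optSet {d : ℕ} (X : Set (EuclideanSpace ℝ (Fin d)))
    (φ : EuclideanSpace ℝ (Fin d) → ℝ) : Set (EuclideanSpace ℝ (Fin d)) :=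
  {x | x ∈ X ∧ ∀ y ∈ X, φ x ≤ φ y}

/-- The optimal value `φ*` (it is `φ x` for every `x ∈ optSet X φ`). -/
def optVal {d : ℕ} (X : Set (EuclideanSpace ℝ (Fin d)))
    (φ : EuclideanSpace ℝ (Fin d) → ℝ) : ℝ :=
  sInf (φ '' X)

/-- The Moreau envelope `φ_λ(x) = min_{y ∈ X} φ(y) + ‖y - x‖² / (2λ)`, a function on all of
`ℝᵈ`. -/
def moreau {d : ℕ} (X : Set (EuclideanSpace ℝ (Fin d))) (lam : ℝ)
    (φ : EuclideanSpace ℝ (Fin d) → ℝ) (x : EuclideanSpace ℝ (Fin d)) : ℝ :=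
  ⨅ y : X, (φ y + 1 / (2 * lam) * ‖(y : EuclideanSpace ℝ (Fin d)) - x‖ ^ 2)

/-- The global KL property with exponent `1/2` and parameter `κ` of a `ρ`-weakly convex `φ`:
`φ(x) - φ* ≤ κ dist²(0, ∂φ(x) + N_X(x))` on `X`, where the distance to the empty set is `∞`. -/
def GlobalKL {d : ℕ} (X : Set (EuclideanSpace ℝ (Fin d))) (ρ : ℝ)
    (φ : EuclideanSpace ℝ (Fin d) → ℝ) (κ : ℝ) : Prop :=
  ∀ x ∈ X, ENNReal.ofReal (φ x - optVal X φ) ≤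
    ENNReal.ofReal κ * (Metric.infEDist 0 (subdiff X ρ φ x + normalCone X x)) ^ 2

section Stochastic

variable {d : ℕ} {S : Type*} [MeasurableSpace S]

/-- The objective `φ(x) = 𝔼_{ξ ∼ ν}[f(x, ξ)] + r(x)`. -/
def objective (ν : Measure S) (f : EuclideanSpace ℝ (Fin d) → S → ℝ)
    (r : EuclideanSpace ℝ (Fin d) → ℝ) (x : EuclideanSpace ℝ (Fin d)) : ℝ :=
  (∫ s, f x s ∂ν) + r x

/-- The `f`-expected Lipschitz bound on the stochastic subgradients `g(x, ξ)`:
`‖g(x, ξ)‖ ≤ L(ξ)` on `X` with `𝔼[L(ξ)²] ≤ L₀² < ∞`. -/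
def BoundDD (X : Set (EuclideanSpace ℝ (Fin d))) (ν : Measure S)
    (g : EuclideanSpace ℝ (Fin d) → S → EuclideanSpace ℝ (Fin d)) : Prop :=
  ∃ (L : S → ℝ) (L₀ : ℝ), Measurable L ∧ 0 ≤ L₀ ∧
    (∀ x ∈ X, ∀ s, ‖g x s‖ ≤ L s) ∧
    ∫⁻ s, ENNReal.ofReal (L s ^ 2) ∂ν ≤ ENNReal.ofReal (L₀ ^ 2)

/-- The `[φ_λ(x) - φ*]`-expected bound on the stochastic subgradients. -/
def BoundThree (X : Set (EuclideanSpace ℝ (Fin d))) (ν : Measure S) (η lam : ℝ)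
    (f : EuclideanSpace ℝ (Fin d) → S → ℝ) (r : EuclideanSpace ℝ (Fin d) → ℝ)
    (g : EuclideanSpace ℝ (Fin d) → S → EuclideanSpace ℝ (Fin d)) : Prop :=
  ∃ c₃ c₄ : ℝ, 0 ≤ c₃ ∧ 0 ≤ c₄ ∧ ∀ x ∈ X, ∃ h ∈ subdiff X η r x,
    ∫⁻ s, ENNReal.ofReal (‖g x s + h‖ ^ 2) ∂ν ≤
      ENNReal.ofReal (c₃ * (moreau X lam (objective ν f r) x - optVal X (objective ν f r)) + c₄)

/-- The `‖∇φ_λ(x)‖`-expected bound on the stochastic subgradients. -/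
def BoundFour (X : Set (EuclideanSpace ℝ (Fin d))) (ν : Measure S) (η lam : ℝ)
    (f : EuclideanSpace ℝ (Fin d) → S → ℝ) (r : EuclideanSpace ℝ (Fin d) → ℝ)
    (g : EuclideanSpace ℝ (Fin d) → S → EuclideanSpace ℝ (Fin d)) : Prop :=
  ∃ c₅ c₆ : ℝ, 0 ≤ c₅ ∧ 0 ≤ c₆ ∧ ∀ x ∈ X, ∃ h ∈ subdiff X η r x,
    ∫⁻ s, ENNReal.ofReal (‖g x s + h‖ ^ 2) ∂ν ≤
      ENNReal.ofReal (c₅ * ‖gradient (moreau X lam (objective ν f r)) x‖ ^ 2 + c₆)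

/-- `x` is a sequence of iterates of the stochastic subgradient method started at `x₀`, with
samples `ξ k`, stochastic subgradients `g (x k) (ξ k)` and stepsizes `α k`: `x (k+1)` minimizes
`⟨g(xᵏ, ξₖ), ·⟩ + r + ‖· - xᵏ‖² / (2 αₖ)` over `X`. The iterate `x k` is a random vector
determined by the samples `ξ 0, …, ξ (k-1)`. -/
def IsStoSubGrad {Ω : Type*} (X : Set (EuclideanSpace ℝ (Fin d)))
    (r : EuclideanSpace ℝ (Fin d) → ℝ)
    (g : EuclideanSpace ℝ (Fin d) → S → EuclideanSpace ℝ (Fin d))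
    (ξ : ℕ → Ω → S) (α : ℕ → ℝ) (x₀ : EuclideanSpace ℝ (Fin d))
    (x : ℕ → Ω → EuclideanSpace ℝ (Fin d)) : Prop :=
  (∀ ω, x 0 ω = x₀) ∧
  (∀ k, Measurable[⨆ j : Fin k, MeasurableSpace.comap (ξ j) inferInstance] (x k)) ∧
  ∀ k ω, x (k + 1) ω ∈ X ∧
    IsMinOn (fun y => ⟪g (x k ω) (ξ k ω), y⟫ + r y + 1 / (2 * α k) * ‖y - x k ω‖ ^ 2) X
      (x (k + 1) ω)

end Stochastic

end StoSubGrad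

end

/-!
Write `F x = 𝔼[f(x, ξ)]`, `φ = F + r`, and `Y x = φ_lam(x) - φ*`. The proof shows that `Y` decreases
in conditional mean along the iterates by a factor `1 - m α k`, up to an error of order `(α k)²`.

*Geometry of the envelope.* Since `lam * (ρ + η) < 1`, the proximal problem at `x` is strongly
convex, so `prox x` is continuous in `x` and satisfies a three-point inequality
(`WeaklyConvexOn.three_point`). Hence `(x - prox x) / lam` is a subgradient of `φ` at `prox x`, and
the KL property gives `Y x ≤ (κ + lam / 2) ‖(x - prox x) / lam‖²`
(`ProxData.moreau_sub_optVal_le_of_globalKL`). The sum `φ` is lower semicontinuous because the mean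
`v x = 𝔼[g(x, ξ)]` of the stochastic subgradients is a subgradient of `F` at every point of `X`.

*One step.* Let `z` be the next iterate. Then `Y z ≤ φ(prox x) - φ* + ‖prox x - z‖² / (2 lam)`, and
the three-point inequality of the step bounds `‖prox x - z‖²` by
`(1 - α t) ‖prox x - x‖²` with `t = 1 / lam - ρ - 2 η`, plus a multiple of
`⟪g(x, ξ) - v x, prox x - x⟫`, plus `O(α²) (‖g(x, ξ) - v x‖² + Y x + 1)`
(`Assumptions.exists_dist_bound`). When the growth condition provides some `h ∈ ∂r(x)`, this `h`
need not depend measurably on `x`; the bias-variance decomposition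
`𝔼‖g + h‖² = 𝔼‖g - v‖² + ‖v + h‖²` removes it from everything that has to be integrated. When the
stochastic subgradients are dominated, `F` is Lipschitz, and the three-point inequality of the
proximal problem at `z` takes the place of the subgradient of `r`. With the KL bound this becomes
a pathwise drift inequality for `Y` (`Assumptions.exists_stepBound`).

*Expectation.* The current iterate and the fresh sample are independent, so by Fubini's theorem the
linear noise term vanishes against any bounded weight depending on the past
(`Assumptions.StepBound.integral_le`).

*Conclusion.* The drift makes `Y` plus a deterministic tail a nonnegative supermartingale, so `Y`
converges almost surely; the limit is `0` by Fatou's lemma, since `∑ α k 𝔼[Y] < ∞` while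
`∑ α k = ∞` (`ae_tendsto_zero_of_drift`). Early stepsizes may violate `α k * η < 1`, in which
case `Y` need not be integrable; the argument therefore starts late and weights the process by
`1 / (1 + Y)` at the starting time. The rate is Chung's lemma (`exists_le_div_of_drift`), applicable
because `m Δ > 1`.
-/

namespace StoSubGrad

/-! ### Weakly convex functions and proximal steps -/

section Deterministic

variable {d : ℕ}

/-- The three-point inequality of a proximal step. No sign of `1 / α - c` is needed. -/
theorem WeaklyConvexOn.three_point {X : Set (EuclideanSpace ℝ (Fin d))} {c α : ℝ}
    {ψ : EuclideanSpace ℝ (Fin d) → ℝ} (hψ : WeaklyConvexOn X c ψ)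
    {v x z : EuclideanSpace ℝ (Fin d)} (hz : z ∈ X)
    (hmin : IsMinOn (fun y => ⟪v, y⟫ + ψ y + 1 / (2 * α) * ‖y - x‖ ^ 2) X z)
    {y : EuclideanSpace ℝ (Fin d)} (hy : y ∈ X) :
    ⟪v, z⟫ + ψ z + 1 / (2 * α) * ‖z - x‖ ^ 2 + (1 / α - c) / 2 * ‖y - z‖ ^ 2 ≤
      ⟪v, y⟫ + ψ y + 1 / (2 * α) * ‖y - x‖ ^ 2 := by
  have key : ∀ t ∈ Set.Ioo (0 : ℝ) 1, ⟪v, z⟫ + ψ z + 1 / (2 * α) * ‖z - x‖ ^ 2 +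
      (1 - t) * ((1 / α - c) / 2 * ‖y - z‖ ^ 2) ≤
      ⟪v, y⟫ + ψ y + 1 / (2 * α) * ‖y - x‖ ^ 2 := by
    rintro t ⟨ht0, ht1⟩
    have h1 := hψ.2 hz hy (sub_nonneg.2 ht1.le) ht0.le (by ring)
    have hw : (1 - t) • z + t • y ∈ X := hψ.1 hz hy (sub_nonneg.2 ht1.le) ht0.le (by ring)
    have h2 := isMinOn_iff.1 hmin _ hw
    have e1 : ‖(1 - t) • z + t • y‖ ^ 2 = ‖z‖ ^ 2 + 2 * t * ⟪z, y - z⟫ + t ^ 2 * ‖y - z‖ ^ 2 := by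
      rw [show (1 - t) • z + t • y = z + t • (y - z) by module, norm_add_sq_real,
        inner_smul_right, norm_smul, mul_pow, Real.norm_eq_abs, sq_abs]; ring
    have e2 : ‖(1 - t) • z + t • y - x‖ ^ 2 =
        ‖z - x‖ ^ 2 + 2 * t * ⟪z - x, y - z⟫ + t ^ 2 * ‖y - z‖ ^ 2 := by
      rw [show (1 - t) • z + t • y - x = (z - x) + t • (y - z) by module, norm_add_sq_real,
        inner_smul_right, norm_smul, mul_pow, Real.norm_eq_abs, sq_abs]; ring
    have e3 : ‖y‖ ^ 2 = ‖z‖ ^ 2 + 2 * ⟪z, y - z⟫ + ‖y - z‖ ^ 2 := by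
      rw [← norm_add_sq_real, add_sub_cancel]
    have e4 : ‖y - x‖ ^ 2 = ‖z - x‖ ^ 2 + 2 * ⟪z - x, y - z⟫ + ‖y - z‖ ^ 2 := by
      rw [← norm_add_sq_real]; congr 2; abel
    have e5 : ⟪v, (1 - t) • z + t • y⟫ = (1 - t) * ⟪v, z⟫ + t * ⟪v, y⟫ := by
      rw [inner_add_right, inner_smul_right, inner_smul_right]
    simp only [smul_eq_mul] at h1
    rw [e1, e3] at h1
    rw [e2, e5] at h2
    rw [e4]
    have e6 : 1 / α = 2 * (1 / (2 * α)) := by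
      rw [one_div, one_div, mul_inv]; ring
    rw [e6]
    generalize 1 / (2 * α) = β at *
    refine le_of_mul_le_mul_left ?_ ht0
    nlinarith
  have hlim : Tendsto (fun t : ℝ => ⟪v, z⟫ + ψ z + 1 / (2 * α) * ‖z - x‖ ^ 2 +
      (1 - t) * ((1 / α - c) / 2 * ‖y - z‖ ^ 2)) (𝓝[>] 0)
      (𝓝 (⟪v, z⟫ + ψ z + 1 / (2 * α) * ‖z - x‖ ^ 2 +
        (1 - 0) * ((1 / α - c) / 2 * ‖y - z‖ ^ 2))) :=
    (Continuous.tendsto (by fun_prop) _).mono_left nhdsWithin_le_nhds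
  rw [sub_zero, one_mul] at hlim
  refine le_of_tendsto hlim ?_
  filter_upwards [Ioo_mem_nhdsGT (zero_lt_one (α := ℝ))] with t ht using key t ht

/-- What the Moreau envelope needs to be well behaved: a closed convex set `X`, a
lower semicontinuous `c`-weakly convex function `φ` that attains its minimum on `X`, and a
parameter `lam` with `lam * c < 1`. -/
structure ProxData (X : Set (EuclideanSpace ℝ (Fin d))) (c lam : ℝ)
    (φ : EuclideanSpace ℝ (Fin d) → ℝ) : Prop where
  closed : IsClosed X
  lsc : LowerSemicontinuousOn φ X
  weaklyConvex : WeaklyConvexOn X c φ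
  nonempty_optSet : (optSet X φ).Nonempty
  lam_pos : 0 < lam
  lam_mul_lt : lam * c < 1

theorem optVal_le {X : Set (EuclideanSpace ℝ (Fin d))} {φ : EuclideanSpace ℝ (Fin d) → ℝ}
    (h : (optSet X φ).Nonempty) {y : EuclideanSpace ℝ (Fin d)} (hy : y ∈ X) :
    optVal X φ ≤ φ y := by
  obtain ⟨z, hz, hmin⟩ := h
  exact csInf_le ⟨φ z, by rintro _ ⟨w, hw, rfl⟩; exact hmin w hw⟩ ⟨y, hy, rfl⟩

namespace ProxData

variable {X : Set (EuclideanSpace ℝ (Fin d))} {c lam : ℝ} {φ : EuclideanSpace ℝ (Fin d) → ℝ}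

theorem exists_isMinOn (h : ProxData X c lam φ) (x : EuclideanSpace ℝ (Fin d)) :
    ∃ z ∈ X, IsMinOn (fun y => φ y + 1 / (2 * lam) * ‖y - x‖ ^ 2) X z := by
  obtain ⟨xs, hxs, hmin⟩ := h.nonempty_optSet
  have hl : 0 < 1 / (2 * lam) := by have := h.lam_pos; positivity
  set K := X ∩ Metric.closedBall x ‖xs - x‖ with hK
  have hKc : IsCompact K := (isCompact_closedBall _ _).inter_left h.closed
  have hxsK : xs ∈ K := ⟨hxs, by simp [dist_eq_norm]⟩
  have hlsc : LowerSemicontinuousOn (fun y => φ y + 1 / (2 * lam) * ‖y - x‖ ^ 2) K :=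
    (h.lsc.mono Set.inter_subset_left).add
      ((Continuous.lowerSemicontinuous (by fun_prop)).lowerSemicontinuousOn _)
  obtain ⟨z, hzK, hz⟩ := hlsc.exists_isMinOn ⟨xs, hxsK⟩ hKc
  refine ⟨z, hzK.1, isMinOn_iff.2 fun y hy => ?_⟩
  by_cases hyK : y ∈ K
  · exact isMinOn_iff.1 hz y hyK
  · have h1 := isMinOn_iff.1 hz xs hxsK
    have h2 : ‖xs - x‖ < ‖y - x‖ := by
      by_contra hcon
      exact hyK ⟨hy, by simpa [dist_eq_norm] using hcon⟩
    have h3 : ‖xs - x‖ ^ 2 ≤ ‖y - x‖ ^ 2 := by gcongr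
    have h4 := hmin y hy
    have := mul_le_mul_of_nonneg_left h3 hl.le
    linarith

/-- The proximal point of `x`: the minimizer over `X` of `φ + ‖· - x‖² / (2 lam)`. -/
noncomputable def prox (h : ProxData X c lam φ) (x : EuclideanSpace ℝ (Fin d)) :
    EuclideanSpace ℝ (Fin d) :=
  (h.exists_isMinOn x).choose

variable (h : ProxData X c lam φ) (x : EuclideanSpace ℝ (Fin d))
include h

theorem prox_mem : h.prox x ∈ X := (h.exists_isMinOn x).choose_spec.1

theorem prox_isMinOn : IsMinOn (fun y => φ y + 1 / (2 * lam) * ‖y - x‖ ^ 2) X (h.prox x) :=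
  (h.exists_isMinOn x).choose_spec.2

theorem prox_three_point {y : EuclideanSpace ℝ (Fin d)} (hy : y ∈ X) :
    φ (h.prox x) + 1 / (2 * lam) * ‖h.prox x - x‖ ^ 2 + (1 / lam - c) / 2 * ‖y - h.prox x‖ ^ 2 ≤
      φ y + 1 / (2 * lam) * ‖y - x‖ ^ 2 := by
  have := h.weaklyConvex.three_point (v := 0) (α := lam) (x := x) (h.prox_mem x)
    (by simpa using h.prox_isMinOn x) hy
  simpa using this

theorem bddBelow_range :
    BddBelow (Set.range fun y : X => φ y + 1 / (2 * lam) *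
      ‖(y : EuclideanSpace ℝ (Fin d)) - x‖ ^ 2) := by
  have := h.lam_pos
  refine ⟨optVal X φ, ?_⟩
  rintro _ ⟨y, rfl⟩
  have h1 := optVal_le h.nonempty_optSet y.2
  have h2 : 0 ≤ 1 / (2 * lam) * ‖(y : EuclideanSpace ℝ (Fin d)) - x‖ ^ 2 := by positivity
  dsimp only
  linarith

theorem moreau_le {y : EuclideanSpace ℝ (Fin d)} (hy : y ∈ X) :
    moreau X lam φ x ≤ φ y + 1 / (2 * lam) * ‖y - x‖ ^ 2 :=
  ciInf_le (h.bddBelow_range x) ⟨y, hy⟩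

theorem moreau_eq :
    moreau X lam φ x = φ (h.prox x) + 1 / (2 * lam) * ‖h.prox x - x‖ ^ 2 := by
  have : Nonempty X := ⟨⟨_, h.prox_mem x⟩⟩
  exact le_antisymm (h.moreau_le x (h.prox_mem x))
    (le_ciInf fun y => isMinOn_iff.1 (h.prox_isMinOn x) y y.2)

theorem measurable_moreau : Measurable (moreau X lam φ) := by
  have : Nonempty X := ⟨⟨_, h.prox_mem 0⟩⟩
  refine UpperSemicontinuous.measurable ?_
  exact upperSemicontinuous_ciInf (fun x => h.bddBelow_range x)
    fun y => (Continuous.upperSemicontinuous (by fun_prop))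

theorem one_div_sub_pos : 0 < 1 / lam - c := by
  have h0 := h.lam_pos
  have : c < 1 / lam := by rw [lt_div_iff₀ h0, mul_comm]; exact h.lam_mul_lt
  linarith

/-- The proximal map is Lipschitz: the objective of the proximal problem is strongly convex. -/
theorem continuous_prox : Continuous h.prox := by
  have hc := h.one_div_sub_pos
  have h0 := h.lam_pos
  have : LipschitzWith (Real.toNNReal (1 / lam / (1 / lam - c))) h.prox := by
    refine LipschitzWith.of_dist_le_mul fun x y => ?_
    rw [Real.coe_toNNReal _ (by positivity), dist_eq_norm, dist_eq_norm, div_mul_eq_mul_div,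
      le_div_iff₀ hc]
    have h1 := h.prox_three_point x (h.prox_mem y)
    have h2 := h.prox_three_point y (h.prox_mem x)
    generalize h.prox x = p at *
    generalize h.prox y = q at *
    have e1 : ‖q - x‖ ^ 2 + ‖p - y‖ ^ 2 - ‖p - x‖ ^ 2 - ‖q - y‖ ^ 2 = 2 * ⟪x - y, p - q⟫ := by
      simp only [norm_sub_sq_real, inner_sub_left, inner_sub_right, real_inner_comm]
      ring
    have e2 : ‖q - p‖ = ‖p - q‖ := norm_sub_rev _ _
    rw [e2] at h1
    have e3 : 1 / (2 * lam) = 1 / lam / 2 := by rw [mul_comm, div_mul_eq_div_div]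
    rw [e3] at h1 h2
    have h3 : (1 / lam - c) * ‖p - q‖ ^ 2 ≤ 1 / lam * ⟪x - y, p - q⟫ := by
      have : 1 / lam / 2 * (‖q - x‖ ^ 2 + ‖p - y‖ ^ 2 - ‖p - x‖ ^ 2 - ‖q - y‖ ^ 2) =
        1 / lam / 2 * (2 * ⟪x - y, p - q⟫) := by rw [e1]
      linarith
    have h4 : 1 / lam * ⟪x - y, p - q⟫ ≤ 1 / lam * (‖x - y‖ * ‖p - q‖) :=
      mul_le_mul_of_nonneg_left (real_inner_le_norm _ _) (by positivity)
    rcases (norm_nonneg (p - q)).eq_or_lt with h5 | h5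
    · rw [← h5, zero_mul]; positivity
    · refine le_of_mul_le_mul_right ?_ h5
      linarith
  exact this.continuous

theorem moreau_sub_optVal_nonneg : 0 ≤ moreau X lam φ x - optVal X φ := by
  have h0 := h.lam_pos
  have := optVal_le h.nonempty_optSet (h.prox_mem x)
  rw [h.moreau_eq]
  have : 0 ≤ 1 / (2 * lam) * ‖h.prox x - x‖ ^ 2 := by positivity
  linarith

theorem norm_prox_sub_sq_le :
    ‖h.prox x - x‖ ^ 2 ≤ 2 * lam * (moreau X lam φ x - optVal X φ) := by
  have h0 := h.lam_pos
  have := optVal_le h.nonempty_optSet (h.prox_mem x)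
  rw [h.moreau_eq]
  have e : 2 * lam * (1 / (2 * lam) * ‖h.prox x - x‖ ^ 2) = ‖h.prox x - x‖ ^ 2 := by
    field_simp
  nlinarith

/-- The gradient of the Moreau envelope is at most the length of the proximal step over `lam`;
where the envelope is not differentiable, `gradient` is `0`. -/
theorem norm_gradient_moreau_le :
    ‖gradient (moreau X lam φ) x‖ ≤ ‖h.prox x - x‖ / lam := by
  have h0 := h.lam_pos
  by_cases hd : DifferentiableAt ℝ (moreau X lam φ) x
  · -- `φ_lam` is touched from above at `x` by a quadratic with gradient `(x - prox x) / lam`.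
    set p := h.prox x with hp
    have hq : HasGradientAt (fun z => φ p + 1 / (2 * lam) * ‖p - z‖ ^ 2)
        ((1 / lam) • (x - p)) x := by
      rw [hasGradientAt_iff_hasFDerivAt]
      have h1 : HasFDerivAt (fun z : EuclideanSpace ℝ (Fin d) => p - z)
        (-(ContinuousLinearMap.id ℝ _)) x := (hasFDerivAt_id x).const_sub p
      have h2 := ((h1.norm_sq).const_mul (1 / (2 * lam))).const_add (φ p)
      have heq : InnerProductSpace.toDual ℝ _ ((1 / lam) • (x - p)) = (1 / (2 * lam)) •
          2 • (innerSL ℝ) (p - x) ∘SL (-ContinuousLinearMap.id ℝ (EuclideanSpace ℝ (Fin d))) := by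
        ext w
        rw [← neg_sub p x]
        simp
        ring
      rw [heq]
      exact h2
    have hg := hd.hasGradientAt
    have hmin : IsLocalMin (fun z => (φ p + 1 / (2 * lam) * ‖p - z‖ ^ 2) - moreau X lam φ z) x := by
      refine Filter.Eventually.of_forall fun z => ?_
      have h1 := h.moreau_le z (h.prox_mem x)
      have h2 := h.moreau_eq x
      dsimp only
      rw [← hp] at h1 h2
      linarith
    have hz := hmin.hasFDerivAt_eq_zero
      ((hasGradientAt_iff_hasFDerivAt.1 hq).sub (hasGradientAt_iff_hasFDerivAt.1 hg))
    rw [← map_sub, LinearIsometryEquiv.map_eq_zero_iff, sub_eq_zero] at hz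
    rw [← hz, norm_smul, norm_sub_rev, Real.norm_of_nonneg (by positivity)]
    apply le_of_eq; ring
  · rw [gradient_eq_zero_of_not_differentiableAt hd, norm_zero]
    positivity

/-- Under the global KL property, the value gap of the Moreau envelope is controlled by the
squared length of the proximal step, because `(x - prox x) / lam` is a subgradient of `φ`
at `prox x`. -/
theorem moreau_sub_optVal_le_of_globalKL {κ : ℝ} (hκ : 0 < κ)
    (hKL : GlobalKL X c φ κ) :
    moreau X lam φ x - optVal X φ ≤ (κ + lam / 2) / lam ^ 2 * ‖h.prox x - x‖ ^ 2 := by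
  have h0 := h.lam_pos
  set p := h.prox x with hp
  have hsub : (1 / lam) • (x - p) ∈ subdiff X c φ p + normalCone X p := by
    refine ⟨(1 / lam) • (x - p), ?_, 0, by intro y _; simp, by simp⟩
    intro y hy
    have h1 := h.prox_three_point x hy
    rw [← hp] at h1
    have e1 : ‖y - x‖ ^ 2 = ‖y - p‖ ^ 2 + 2 * ⟪y - p, p - x⟫ + ‖p - x‖ ^ 2 := by
      rw [← norm_add_sq_real]; congr 2; abel
    have e2 : ‖y‖ ^ 2 = ‖p‖ ^ 2 + 2 * ⟪p, y - p⟫ + ‖y - p‖ ^ 2 := by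
      rw [← norm_add_sq_real, add_sub_cancel]
    have e3 : 1 / (2 * lam) = 1 / lam / 2 := by rw [mul_comm, div_mul_eq_div_div]
    have e4 : ⟪y - p, p - x⟫ = - ⟪x - p, y - p⟫ := by
      rw [real_inner_comm, ← neg_sub x p, inner_neg_left]
    rw [e1, e3, e4] at h1
    dsimp only
    rw [inner_add_left, inner_smul_left, inner_smul_left, e2]
    simp only [conj_trivial]
    linarith
  have h1 := hKL p (h.prox_mem x)
  have h2 : Metric.infEDist 0 (subdiff X c φ p + normalCone X p) ≤
      ENNReal.ofReal (‖p - x‖ / lam) := by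
    refine (Metric.infEDist_le_edist_of_mem hsub).trans ?_
    rw [edist_dist, dist_zero_left, norm_smul, norm_sub_rev, Real.norm_of_nonneg (by positivity)]
    apply le_of_eq; congr 1; ring
  have h3 : ENNReal.ofReal (φ p - optVal X φ) ≤ ENNReal.ofReal (κ * (‖p - x‖ / lam) ^ 2) := by
    refine h1.trans ?_
    rw [ENNReal.ofReal_mul hκ.le, ENNReal.ofReal_pow (by positivity)]
    gcongr
  rw [ENNReal.ofReal_le_ofReal_iff (by positivity)] at h3
  rw [h.moreau_eq, ← hp]
  have e : (κ + lam / 2) / lam ^ 2 * ‖p - x‖ ^ 2 =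
      κ * (‖p - x‖ / lam) ^ 2 + 1 / (2 * lam) * ‖p - x‖ ^ 2 := by
    field_simp
  linarith

end ProxData

end Deterministic

/-! ### One step of the method along a sample path -/

section Step

variable {d : ℕ} {X : Set (EuclideanSpace ℝ (Fin d))}

theorem mem_subdiff_iff {c : ℝ} {ψ : EuclideanSpace ℝ (Fin d) → ℝ}
    {v x : EuclideanSpace ℝ (Fin d)} :
    v ∈ subdiff X c ψ x ↔ ∀ y ∈ X, ψ x + ⟪v, y - x⟫ - c / 2 * ‖y - x‖ ^ 2 ≤ ψ y := by
  have e : ∀ y, ‖y‖ ^ 2 = ‖x‖ ^ 2 + 2 * ⟪x, y - x⟫ + ‖y - x‖ ^ 2 := fun y => by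
    rw [← norm_add_sq_real, add_sub_cancel]
  refine forall₂_congr fun y _ => ?_
  dsimp only
  rw [inner_add_left, inner_smul_left, e y, conj_trivial]
  constructor <;> intro h <;> linarith

/-- A function on a convex set which has, at each point, a subgradient of norm at most `L` up to
a quadratic error is `L`-Lipschitz: along a segment cut into `n` pieces the quadratic errors
add up to `O(1 / n)`. -/
theorem sub_le_of_forall_exists_subgradient (hX : Convex ℝ X) {F : EuclideanSpace ℝ (Fin d) → ℝ}
    {ρ L : ℝ}
    (hF : ∀ x ∈ X, ∃ v, ‖v‖ ≤ L ∧ ∀ y ∈ X, F x + ⟪v, y - x⟫ - ρ / 2 * ‖y - x‖ ^ 2 ≤ F y)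
    {x y : EuclideanSpace ℝ (Fin d)} (hx : x ∈ X) (hy : y ∈ X) :
    F y - F x ≤ L * ‖y - x‖ := by
  have hloc : ∀ a ∈ X, ∀ b ∈ X, F b - F a ≤ L * ‖b - a‖ + ρ / 2 * ‖b - a‖ ^ 2 := by
    intro a ha b hb
    obtain ⟨v, hvL, hv⟩ := hF b hb
    have h1 := hv a ha
    have h2 : -⟪v, a - b⟫ ≤ ‖v‖ * ‖a - b‖ :=
      (neg_le_abs _).trans (abs_real_inner_le_norm _ _)
    have h3 : ‖v‖ * ‖a - b‖ ≤ L * ‖a - b‖ := by gcongr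
    rw [norm_sub_rev b a]
    linarith
  have hn : ∀ n : ℕ, F y - F x ≤ L * ‖y - x‖ + ρ / 2 * ‖y - x‖ ^ 2 * (1 / ((n : ℝ) + 1)) := by
    intro n
    have hN : (0 : ℝ) < (n : ℝ) + 1 := by positivity
    set z : ℕ → EuclideanSpace ℝ (Fin d) := fun i => x + ((i : ℝ) / ((n : ℝ) + 1)) • (y - x) with hz
    have hzX : ∀ i ≤ n + 1, z i ∈ X := by
      intro i hi
      refine hX.add_smul_sub_mem hx hy ⟨by positivity, ?_⟩
      rw [div_le_one hN]
      exact_mod_cast hi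
    have hzs : ∀ i, ‖z (i + 1) - z i‖ = ‖y - x‖ / ((n : ℝ) + 1) := by
      intro i
      have : z (i + 1) - z i = (1 / ((n : ℝ) + 1)) • (y - x) := by
        simp only [hz]
        push_cast
        rw [add_sub_add_left_eq_sub, ← sub_smul]
        congr 1
        ring
      rw [this, norm_smul, Real.norm_of_nonneg (by positivity)]
      ring
    have hsum : ∑ i ∈ Finset.range (n + 1), (F (z (i + 1)) - F (z i)) = F y - F x := by
      rw [Finset.sum_range_sub (fun i => F (z i))]
      congr 2
      · simp only [hz]
        push_cast
        rw [div_self hN.ne']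
        simp
      · simp [hz]
    rw [← hsum]
    have : ∀ i ∈ Finset.range (n + 1), F (z (i + 1)) - F (z i) ≤
        L * (‖y - x‖ / ((n : ℝ) + 1)) + ρ / 2 * (‖y - x‖ / ((n : ℝ) + 1)) ^ 2 := by
      intro i hi
      have hi' := Finset.mem_range.1 hi
      have := hloc (z i) (hzX i hi'.le) (z (i + 1)) (hzX (i + 1) hi')
      rwa [hzs] at this
    refine (Finset.sum_le_sum this).trans (le_of_eq ?_)
    rw [Finset.sum_const, Finset.card_range, nsmul_eq_mul]
    push_cast
    field_simp
  have hlim : Tendsto (fun n : ℕ => L * ‖y - x‖ + ρ / 2 * ‖y - x‖ ^ 2 * (1 / ((n : ℝ) + 1)))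
      atTop (𝓝 (L * ‖y - x‖ + ρ / 2 * ‖y - x‖ ^ 2 * 0)) :=
    (tendsto_one_div_add_atTop_nhds_zero_nat.const_mul _).const_add _
  rw [mul_zero, add_zero] at hlim
  exact ge_of_tendsto' hlim hn

theorem WeaklyConvexOn.step_ineq {η α : ℝ} {r : EuclideanSpace ℝ (Fin d) → ℝ}
    (hr : WeaklyConvexOn X η r) (hα : 0 < α) {G x z y : EuclideanSpace ℝ (Fin d)} (hz : z ∈ X)
    (hmin : IsMinOn (fun y => ⟪G, y⟫ + r y + 1 / (2 * α) * ‖y - x‖ ^ 2) X z) (hy : y ∈ X) :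
    (1 - α * η) * ‖y - z‖ ^ 2 + ‖z - x‖ ^ 2 ≤
      ‖y - x‖ ^ 2 + 2 * α * (⟪G, y - z⟫ + r y - r z) := by
  have h := hr.three_point hz hmin hy
  have h2 := mul_le_mul_of_nonneg_left h (show 0 ≤ 2 * α by positivity)
  rw [inner_sub_right]
  have e1 : 2 * α * (1 / (2 * α)) = 1 := by field_simp
  have e2 : 2 * α * ((1 / α - η) / 2) = 1 - α * η := by field_simp
  linear_combination h2 + (‖y - x‖ ^ 2 - ‖z - x‖ ^ 2) * e1 - ‖y - z‖ ^ 2 * e2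

/-- Young's inequality in the form used to absorb the step `e` into its own square. -/
theorem two_mul_inner_le {α γ : ℝ} (hγ : 0 < γ) (a e : EuclideanSpace ℝ (Fin d)) :
    2 * α * ⟪a, e⟫ ≤ γ * ‖e‖ ^ 2 + α ^ 2 / γ * ‖a‖ ^ 2 := by
  have h := sq_nonneg ‖(α / γ) • a - e‖
  rw [norm_sub_sq_real, norm_smul, mul_pow, Real.norm_eq_abs, sq_abs, inner_smul_left,
    conj_trivial] at h
  have h2 := mul_nonneg hγ.le h
  have e1 : γ * ((α / γ) ^ 2 * ‖a‖ ^ 2 - 2 * (α / γ * ⟪a, e⟫) + ‖e‖ ^ 2) =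
      α ^ 2 / γ * ‖a‖ ^ 2 - 2 * α * ⟪a, e⟫ + γ * ‖e‖ ^ 2 := by field_simp
  linarith

theorem norm_add_sq_le_two_mul (a b : EuclideanSpace ℝ (Fin d)) :
    ‖a + b‖ ^ 2 ≤ 2 * (‖a‖ ^ 2 + ‖b‖ ^ 2) := by
  have h := sq_nonneg ‖a - b‖
  rw [norm_sub_sq_real] at h
  rw [norm_add_sq_real]
  linarith

variable {η ρ lam : ℝ} {F r : EuclideanSpace ℝ (Fin d) → ℝ}

/-- One step when a subgradient `h` of `r` at `x` makes `v + h` small. The noise is `G - v`. -/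
theorem ProxData.step_of_subdiff (hp : ProxData X (ρ + η) lam (fun y => F y + r y))
    (hr : WeaklyConvexOn X η r) (hη : 0 ≤ η) (ht : 0 ≤ 1 / lam - ρ - 2 * η)
    {α B : ℝ} (hα : 0 < α) (hαη : α * η < 1) {x z v G h : EuclideanSpace ℝ (Fin d)} (hx : x ∈ X)
    (hv : v ∈ subdiff X ρ F x) (hh : h ∈ subdiff X η r x) (hB : ‖v + h‖ ^ 2 ≤ B) (hz : z ∈ X)
    (hmin : IsMinOn (fun y => ⟪G, y⟫ + r y + 1 / (2 * α) * ‖y - x‖ ^ 2) X z) :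
    ‖hp.prox x - z‖ ^ 2 ≤ (1 - α * (1 / lam - ρ - 2 * η)) * ‖hp.prox x - x‖ ^ 2 +
      2 * α / (1 - α * η) * ⟪G - v, hp.prox x - x⟫ +
      2 * α ^ 2 / (1 - α * η) ^ 2 * (‖G - v‖ ^ 2 + B) := by
  have hγ : 0 < 1 - α * η := by linarith
  have hpX := hp.prox_mem x
  have h1 := hr.step_ineq hα hz hmin hpX
  have h2 := mem_subdiff_iff.1 hh z hz
  have h3 := mem_subdiff_iff.1 hv _ hpX
  have h4 := hp.prox_three_point x hx
  generalize hp.prox x = p at *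
  have h5 := two_mul_inner_le (α := α) hγ (-((G - v) + (v + h))) (z - x)
  rw [norm_neg] at h5
  have h6 := norm_add_sq_le_two_mul (G - v) (v + h)
  have h7 : α ^ 2 / (1 - α * η) * ‖G - v + (v + h)‖ ^ 2 ≤
      α ^ 2 / (1 - α * η) * (2 * (‖G - v‖ ^ 2 + B)) := by
    refine mul_le_mul_of_nonneg_left ?_ (by positivity)
    linarith
  have e1 : ⟪G, p - z⟫ = ⟪G - v, p - x⟫ + ⟪v, p - x⟫ + ⟪-((G - v) + (v + h)), z - x⟫
      + ⟪h, z - x⟫ := by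
    simp only [inner_sub_left, inner_sub_right, inner_neg_left, inner_add_left]
    ring
  rw [e1] at h1
  have e2 : ‖x - p‖ = ‖p - x‖ := norm_sub_rev _ _
  rw [e2, sub_self, norm_zero] at h4
  have e3 : 1 / (2 * lam) = 1 / lam / 2 := by rw [mul_comm, div_mul_eq_div_div]
  rw [e3] at h4
  have h8 : ⟪v, p - x⟫ + r p - r x ≤ -(1 / lam - ρ - η / 2) * ‖p - x‖ ^ 2 := by linarith
  have h9 : (1 - α * η) * ‖p - z‖ ^ 2 ≤ (1 - 2 * α * (1 / lam - ρ - η / 2)) * ‖p - x‖ ^ 2 +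
      2 * α * ⟪G - v, p - x⟫ + α ^ 2 / (1 - α * η) * (2 * (‖G - v‖ ^ 2 + B)) := by
    have h10 : 2 * α * (r x + ⟪h, z - x⟫ - η / 2 * ‖z - x‖ ^ 2 - r z) ≤ 0 :=
      mul_nonpos_of_nonneg_of_nonpos (by positivity) (by linarith)
    have h11 : 2 * α * (⟪v, p - x⟫ + r p - r x) ≤
      2 * α * (-(1 / lam - ρ - η / 2) * ‖p - x‖ ^ 2) :=
      mul_le_mul_of_nonneg_left h8 (by positivity)
    linarith
  have h12 : (1 - 2 * α * (1 / lam - ρ - η / 2)) * ‖p - x‖ ^ 2 ≤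
      (1 - α * η) * (1 - α * (1 / lam - ρ - 2 * η)) * ‖p - x‖ ^ 2 := by
    refine mul_le_mul_of_nonneg_right ?_ (sq_nonneg _)
    have : 0 ≤ α * η * (α * (1 / lam - ρ - 2 * η)) := by positivity
    nlinarith
  refine le_of_mul_le_mul_left (h9.trans ((add_le_add_left (add_le_add_left h12 _) _).trans
    (le_of_eq ?_))) hγ
  field_simp

/-- One step when `F` is `L`-Lipschitz, for a small stepsize. -/
theorem ProxData.step_of_lipschitz (hp : ProxData X (ρ + η) lam (fun y => F y + r y))
    (hr : WeaklyConvexOn X η r) (ht : 0 ≤ 1 / lam - ρ - 2 * η)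
    (hη : 0 ≤ η) (hρ : 0 ≤ ρ) {L : ℝ}
    (hL : ∀ a ∈ X, ∀ b ∈ X, F b - F a ≤ L * ‖b - a‖)
    {α : ℝ} (hα : 0 < α) (hαlam : α ≤ lam / 2) {x z v G : EuclideanSpace ℝ (Fin d)} (hx : x ∈ X)
    (hv : v ∈ subdiff X ρ F x) (hvL : ‖v‖ ≤ L) (hz : z ∈ X)
    (hmin : IsMinOn (fun y => ⟪G, y⟫ + r y + 1 / (2 * α) * ‖y - x‖ ^ 2) X z) :
    ‖hp.prox x - z‖ ^ 2 ≤ (1 - α * (1 / lam - ρ - 2 * η)) * ‖hp.prox x - x‖ ^ 2 +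
      2 * α / (1 + α * (1 / lam - ρ - 2 * η)) * ⟪G - v, hp.prox x - x⟫ +
      4 * α ^ 2 * (‖G - v‖ ^ 2 + 4 * L ^ 2) := by
  have hl := hp.lam_pos
  have hpX := hp.prox_mem x
  have h1 := hr.step_ineq hα hz hmin hpX
  have h3 := mem_subdiff_iff.1 hv _ hpX
  have h4 := hp.prox_three_point x hz
  have h5 := hL x hx z hz
  generalize hp.prox x = p at *
  set t := 1 / lam - ρ - 2 * η with ht_def
  have e1 : ⟪G, p - z⟫ = ⟪G - v, p - x⟫ + ⟪v, p - x⟫ - ⟪G, z - x⟫ := by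
    simp only [inner_sub_left, inner_sub_right]
    ring
  rw [e1] at h1
  have h6 : -⟪G, z - x⟫ ≤ (‖G - v‖ + L) * ‖z - x‖ := by
    refine (neg_le_abs _).trans ((abs_real_inner_le_norm _ _).trans ?_)
    gcongr
    calc ‖G‖ = ‖(G - v) + v‖ := by rw [sub_add_cancel]
      _ ≤ ‖G - v‖ + ‖v‖ := norm_add_le _ _
      _ ≤ _ := by gcongr
  have e2 : ‖z - p‖ = ‖p - z‖ := norm_sub_rev _ _
  rw [e2] at h4
  have e3 : 1 / (2 * lam) = 1 / lam / 2 := by rw [mul_comm, div_mul_eq_div_div]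
  rw [e3] at h4
  have hal : α * (1 / lam) ≤ 1 / 2 := by
    rw [mul_one_div, div_le_iff₀ hl]; linarith
  -- the terms in `‖z - x‖` are maximized over that length
  have h7 : 2 * α * ((‖G - v‖ + 2 * L) * ‖z - x‖) - (1 - α * (1 / lam)) * ‖z - x‖ ^ 2 ≤
      4 * α ^ 2 * (‖G - v‖ ^ 2 + 4 * L ^ 2) := by
    have h8 := sq_nonneg (‖z - x‖ - 2 * α * (‖G - v‖ + 2 * L))
    have h9 := mul_nonneg (sq_nonneg α) (sq_nonneg (‖G - v‖ - 2 * L))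
    have h10 := mul_le_mul_of_nonneg_right hal (sq_nonneg ‖z - x‖)
    nlinarith
  have h8 : (1 + α * t) * ‖p - z‖ ^ 2 ≤ (1 - α * (1 / lam - ρ)) * ‖p - x‖ ^ 2 +
      2 * α * ⟪G - v, p - x⟫ + 4 * α ^ 2 * (‖G - v‖ ^ 2 + 4 * L ^ 2) := by
    have h10 : 2 * α * (⟪v, p - x⟫ + r p - r z - ⟪G, z - x⟫) ≤
        2 * α * (ρ / 2 * ‖p - x‖ ^ 2 + (‖G - v‖ + 2 * L) * ‖z - x‖ + 1 / lam / 2 * ‖z - x‖ ^ 2 -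
          1 / lam / 2 * ‖p - x‖ ^ 2 - (1 / lam - (ρ + η)) / 2 * ‖p - z‖ ^ 2) :=
      mul_le_mul_of_nonneg_left (by linarith) (by positivity)
    rw [ht_def]
    linarith
  have hat : 0 ≤ α * t := by positivity
  have h1t : 0 < 1 + α * t := by positivity
  have h9 : (1 - α * (1 / lam - ρ)) * ‖p - x‖ ^ 2 ≤
      (1 + α * t) * ((1 - α * t) * ‖p - x‖ ^ 2) := by
    rw [← mul_assoc]
    refine mul_le_mul_of_nonneg_right ?_ (sq_nonneg _)
    have h11 : α * t ≤ α * (1 / lam - ρ) := mul_le_mul_of_nonneg_left (by linarith) hα.le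
    have h12 : α * t ≤ 1 := by nlinarith
    nlinarith
  have h10 : 4 * α ^ 2 * (‖G - v‖ ^ 2 + 4 * L ^ 2) ≤
      (1 + α * t) * (4 * α ^ 2 * (‖G - v‖ ^ 2 + 4 * L ^ 2)) :=
    le_mul_of_one_le_left (by positivity) (by linarith)
  refine le_of_mul_le_mul_left ?_ h1t
  have e4 : (1 + α * t) * (2 * α / (1 + α * t) * ⟪G - v, p - x⟫) = 2 * α * ⟪G - v, p - x⟫ := by
    field_simp
  linarith

/-- A crude bound on one step when `F` is `L`-Lipschitz, for any stepsize with `α * η < 1`. -/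
theorem ProxData.step_crude_of_lipschitz (hp : ProxData X (ρ + η) lam (fun y => F y + r y))
    (hr : WeaklyConvexOn X η r) {L : ℝ}
    (hL : ∀ a ∈ X, ∀ b ∈ X, F b - F a ≤ L * ‖b - a‖)
    {α : ℝ} (hα : 0 < α) {x z v G : EuclideanSpace ℝ (Fin d)} (hx : x ∈ X)
    (hv : v ∈ subdiff X ρ F x) (hvL : ‖v‖ ≤ L) (hz : z ∈ X)
    (hmin : IsMinOn (fun y => ⟪G, y⟫ + r y + 1 / (2 * α) * ‖y - x‖ ^ 2) X z) :
    (1 - α * η) * ‖hp.prox x - z‖ ^ 2 ≤ (1 + α * ρ) * ‖hp.prox x - x‖ ^ 2 +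
      2 * α * ⟪G - v, hp.prox x - x⟫ +
      2 * α * (moreau X lam (fun y => F y + r y) x - optVal X (fun y => F y + r y)) +
      2 * α ^ 2 * (‖G - v‖ ^ 2 + 4 * L ^ 2) := by
  have hl := hp.lam_pos
  have hpX := hp.prox_mem x
  have h1 := hr.step_ineq hα hz hmin hpX
  have h3 := mem_subdiff_iff.1 hv _ hpX
  have h4 := optVal_le hp.nonempty_optSet hz
  have h2 := hp.moreau_eq x
  have h5 := hL x hx z hz
  generalize hp.prox x = p at *
  generalize moreau X lam (fun y => F y + r y) x = M at *
  generalize optVal X (fun y => F y + r y) = m at *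
  have e1 : ⟪G, p - z⟫ = ⟪G - v, p - x⟫ + ⟪v, p - x⟫ - ⟪G, z - x⟫ := by
    simp only [inner_sub_left, inner_sub_right]
    ring
  rw [e1] at h1
  have h6 : -⟪G, z - x⟫ ≤ (‖G - v‖ + L) * ‖z - x‖ := by
    refine (neg_le_abs _).trans ((abs_real_inner_le_norm _ _).trans ?_)
    gcongr
    calc ‖G‖ = ‖(G - v) + v‖ := by rw [sub_add_cancel]
      _ ≤ ‖G - v‖ + ‖v‖ := norm_add_le _ _
      _ ≤ _ := by gcongr
  have h0 : 0 ≤ 1 / (2 * lam) * ‖p - x‖ ^ 2 := by positivity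
  have h7 : 2 * α * ((‖G - v‖ + 2 * L) * ‖z - x‖) - ‖z - x‖ ^ 2 ≤
      2 * α ^ 2 * (‖G - v‖ ^ 2 + 4 * L ^ 2) := by
    have h8 := sq_nonneg (‖z - x‖ - α * (‖G - v‖ + 2 * L))
    have h9 := mul_nonneg (sq_nonneg α) (sq_nonneg (‖G - v‖ - 2 * L))
    nlinarith
  have h10 : 2 * α * (⟪v, p - x⟫ + r p - r z - ⟪G, z - x⟫) ≤
      2 * α * (ρ / 2 * ‖p - x‖ ^ 2 + (‖G - v‖ + 2 * L) * ‖z - x‖ + (M - m)) :=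
    mul_le_mul_of_nonneg_left (by linarith) (by positivity)
  linarith

end Step

/-! ### The expected problem and the noise of the stochastic subgradients -/

section Expected

variable {d : ℕ} {S : Type*} [MeasurableSpace S]

theorem memLp_two_of_lintegral_sq_lt_top {ν : Measure S} {G : S → EuclideanSpace ℝ (Fin d)}
    (hG : AEStronglyMeasurable G ν) (h : ∫⁻ s, ENNReal.ofReal (‖G s‖ ^ 2) ∂ν < ∞) :
    MemLp G 2 ν := by
  rw [memLp_two_iff_integrable_sq_norm hG]
  refine ⟨hG.norm.pow 2, ?_⟩
  rwa [hasFiniteIntegral_iff_ofReal (Eventually.of_forall fun s => sq_nonneg _)]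

/-- The bias-variance decomposition of the second moment of `G + h`. -/
theorem integral_norm_add_sq {ν : Measure S} [IsProbabilityMeasure ν]
    {G : S → EuclideanSpace ℝ (Fin d)} (hG : MemLp G 2 ν) (h : EuclideanSpace ℝ (Fin d)) :
    ∫ s, ‖G s + h‖ ^ 2 ∂ν = ∫ s, ‖G s - ∫ s', G s' ∂ν‖ ^ 2 ∂ν + ‖(∫ s', G s' ∂ν) + h‖ ^ 2 := by
  set v := ∫ s', G s' ∂ν with hv
  have hint : Integrable G ν := hG.integrable one_le_two
  have hG' : MemLp (fun s => G s - v) 2 ν := hG.sub (memLp_const v)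
  have hint' : Integrable (fun s => G s - v) ν := hint.sub (integrable_const v)
  have h0 : ∫ s, (G s - v) ∂ν = 0 := by
    rw [integral_sub hint (integrable_const v), integral_const]
    simp [hv]
  have h1 : ∀ s, ‖G s + h‖ ^ 2 = ‖G s - v‖ ^ 2 + (2 * ⟪v + h, G s - v⟫ + ‖v + h‖ ^ 2) := by
    intro s
    rw [show G s + h = (G s - v) + (v + h) by abel, norm_add_sq_real, real_inner_comm]
    ring
  have h2 : Integrable (fun s => ⟪v + h, G s - v⟫) ν := hint'.const_inner _
  have h3 : Integrable (fun s => 2 * ⟪v + h, G s - v⟫ + ‖v + h‖ ^ 2) ν :=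
    (h2.const_mul 2).add (integrable_const _)
  simp_rw [h1]
  rw [integral_add ((memLp_two_iff_integrable_sq_norm hG'.1).1 hG') h3,
    integral_add (h2.const_mul 2) (integrable_const _),
    integral_const_mul, integral_inner hint', h0]
  simp

theorem WeaklyConvexOn.mono {X : Set (EuclideanSpace ℝ (Fin d))} {c c' : ℝ} (h : c ≤ c')
    {ψ : EuclideanSpace ℝ (Fin d) → ℝ} (hψ : WeaklyConvexOn X c ψ) : WeaklyConvexOn X c' ψ := by
  have h1 : ConvexOn ℝ X fun x : EuclideanSpace ℝ (Fin d) => (c' - c) / 2 * ‖x‖ ^ 2 := by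
    have h2 : ConvexOn ℝ X fun x : EuclideanSpace ℝ (Fin d) => ‖x‖ ^ 2 :=
      ((convexOn_univ_norm).subset (Set.subset_univ _) hψ.1).pow (fun _ _ => norm_nonneg _) 2
    exact h2.smul (show 0 ≤ (c' - c) / 2 by linarith)
  refine (hψ.add h1).congr fun x _ => ?_
  simp only [Pi.add_apply]
  ring

theorem WeaklyConvexOn.integral {ν : Measure S} {X : Set (EuclideanSpace ℝ (Fin d))}
    (hX : Convex ℝ X) {f : EuclideanSpace ℝ (Fin d) → S → ℝ} {c : S → ℝ} (hc : Integrable c ν)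
    (hfint : ∀ x ∈ X, Integrable (f x) ν) (hf : ∀ s, WeaklyConvexOn X (c s) (fun x => f x s)) :
    WeaklyConvexOn X (∫ s, c s ∂ν) (fun x => ∫ s, f x s ∂ν) := by
  have hI : ∀ x ∈ X, Integrable (fun s => f x s + c s / 2 * ‖x‖ ^ 2) ν := fun x hx =>
    (hfint x hx).add ((hc.div_const 2).mul_const _)
  have e : ∀ x ∈ X, (∫ s, f x s ∂ν) + (∫ s, c s ∂ν) / 2 * ‖x‖ ^ 2 =
      ∫ s, (f x s + c s / 2 * ‖x‖ ^ 2) ∂ν := fun x hx => by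
    rw [integral_add (hfint x hx) ((hc.div_const 2).mul_const _), integral_mul_const,
      integral_div]
  refine ⟨hX, fun x hx y hy a b ha hb hab => ?_⟩
  dsimp only
  rw [e x hx, e y hy, e _ (hX hx hy ha hb hab), smul_eq_mul, smul_eq_mul, ← integral_const_mul,
    ← integral_const_mul, ← integral_add ((hI x hx).const_mul a) ((hI y hy).const_mul b)]
  exact integral_mono (hI _ (hX hx hy ha hb hab))
    (((hI x hx).const_mul a).add ((hI y hy).const_mul b)) fun s => (hf s).2 hx hy ha hb hab

theorem WeaklyConvexOn.add {X : Set (EuclideanSpace ℝ (Fin d))} {c c' : ℝ}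
    {ψ ψ' : EuclideanSpace ℝ (Fin d) → ℝ} (hψ : WeaklyConvexOn X c ψ)
    (hψ' : WeaklyConvexOn X c' ψ') : WeaklyConvexOn X (c + c') (fun x => ψ x + ψ' x) := by
  refine (ConvexOn.add hψ hψ').congr fun x _ => ?_
  simp only [Pi.add_apply]
  ring

theorem integral_mem_subdiff {ν : Measure S} {X : Set (EuclideanSpace ℝ (Fin d))}
    {f : EuclideanSpace ℝ (Fin d) → S → ℝ} {c : S → ℝ} {ρ : ℝ} (hc : Integrable c ν)
    (hρ : ∫ s, c s ∂ν ≤ ρ) (hfint : ∀ x ∈ X, Integrable (f x) ν)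
    {x : EuclideanSpace ℝ (Fin d)} (hx : x ∈ X) {G : S → EuclideanSpace ℝ (Fin d)}
    (hGint : Integrable G ν) (hG : ∀ s, G s ∈ subdiff X (c s) (fun y => f y s) x) :
    ∫ s, G s ∂ν ∈ subdiff X ρ (fun y => ∫ s, f y s ∂ν) x := by
  rw [mem_subdiff_iff]
  intro y hy
  have hI1 : Integrable (fun s => ⟪G s, y - x⟫) ν := hGint.inner_const _
  have hI2 : Integrable (fun s => c s / 2 * ‖y - x‖ ^ 2) ν := (hc.div_const 2).mul_const _
  have h1 : ∫ s, (f x s + ⟪G s, y - x⟫ - c s / 2 * ‖y - x‖ ^ 2) ∂ν ≤ ∫ s, f y s ∂ν :=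
    integral_mono (((hfint x hx).add hI1).sub hI2) (hfint y hy)
      fun s => mem_subdiff_iff.1 (hG s) y hy
  have hI3 : Integrable (fun s => f x s + ⟪G s, y - x⟫) ν := (hfint x hx).add hI1
  rw [integral_sub hI3 hI2, integral_add (hfint x hx) hI1,
    integral_mul_const, integral_div] at h1
  have h2 : ∫ s, ⟪G s, y - x⟫ ∂ν = ⟪∫ s, G s ∂ν, y - x⟫ := by
    simp_rw [real_inner_comm (y - x)]
    rw [integral_inner hGint]
  rw [h2] at h1
  have h3 : (∫ s, c s ∂ν) / 2 * ‖y - x‖ ^ 2 ≤ ρ / 2 * ‖y - x‖ ^ 2 := by gcongr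
  linarith

/-- A subgradient at `x` gives a continuous minorant that touches the function at `x`. -/
theorem lowerSemicontinuousOn_of_subdiff_nonempty {X : Set (EuclideanSpace ℝ (Fin d))} {c : ℝ}
    {ψ : EuclideanSpace ℝ (Fin d) → ℝ} (h : ∀ x ∈ X, (subdiff X c ψ x).Nonempty) :
    LowerSemicontinuousOn ψ X := by
  intro x hx
  obtain ⟨v, hv⟩ := h x hx
  intro a ha
  have hlim : Tendsto (fun y => ψ x + ⟪v, y - x⟫ - c / 2 * ‖y - x‖ ^ 2) (𝓝[X] x) (𝓝 (ψ x)) := by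
    have hc : Continuous fun y => ψ x + ⟪v, y - x⟫ - c / 2 * ‖y - x‖ ^ 2 := by fun_prop
    have := (hc.tendsto x).mono_left (nhdsWithin_le_nhds (s := X))
    simpa using this
  filter_upwards [hlim.eventually (lt_mem_nhds ha), self_mem_nhdsWithin] with y hy hyX
  exact hy.trans_le (mem_subdiff_iff.1 hv y hyX)

/-- The standing assumptions on the stochastic problem and on the stochastic subgradients. -/
structure Assumptions (ν : Measure S) (X : Set (EuclideanSpace ℝ (Fin d)))
    (f : EuclideanSpace ℝ (Fin d) → S → ℝ) (r : EuclideanSpace ℝ (Fin d) → ℝ)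
    (η ρ lam : ℝ) (ρξ : S → ℝ)
    (g : EuclideanSpace ℝ (Fin d) → S → EuclideanSpace ℝ (Fin d)) : Prop where
  closed : IsClosed X
  convex : Convex ℝ X
  integrable_f : ∀ x ∈ X, Integrable (f x) ν
  lsc_r : LowerSemicontinuousOn r X
  η_nonneg : 0 ≤ η
  integrable_ρξ : Integrable ρξ ν
  integral_ρξ_nonneg : 0 ≤ ∫ s, ρξ s ∂ν
  integral_ρξ_le : ∫ s, ρξ s ∂ν ≤ ρ
  weaklyConvex_r : WeaklyConvexOn X η r
  weaklyConvex_f : ∀ s, WeaklyConvexOn X (ρξ s) (fun x => f x s)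
  nonempty_optSet : (optSet X (objective ν f r)).Nonempty
  measurable_g : Measurable (Function.uncurry g)
  g_mem : ∀ x ∈ X, ∀ s, g x s ∈ subdiff X (ρξ s) (fun y => f y s) x
  lam_pos : 0 < lam
  lam_mul_lt : lam * (ρ + 2 * η) < 1
  bound : BoundDD X ν g ∨ BoundThree X ν η lam f r g ∨ BoundFour X ν η lam f r g

/-- The mean `𝔼[g(x, ξ)]` of the stochastic subgradients at `x`. -/
noncomputable def meanGrad (ν : Measure S)
    (g : EuclideanSpace ℝ (Fin d) → S → EuclideanSpace ℝ (Fin d))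
    (x : EuclideanSpace ℝ (Fin d)) : EuclideanSpace ℝ (Fin d) := ∫ s, g x s ∂ν

namespace Assumptions

variable {ν : Measure S} [IsProbabilityMeasure ν] {X : Set (EuclideanSpace ℝ (Fin d))}
  {f : EuclideanSpace ℝ (Fin d) → S → ℝ} {r : EuclideanSpace ℝ (Fin d) → ℝ}
  {η ρ lam : ℝ} {ρξ : S → ℝ} {g : EuclideanSpace ℝ (Fin d) → S → EuclideanSpace ℝ (Fin d)}
  (A : Assumptions ν X f r η ρ lam ρξ g)
include A

omit [IsProbabilityMeasure ν] in
theorem ρ_nonneg : 0 ≤ ρ := A.integral_ρξ_nonneg.trans A.integral_ρξ_le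

omit [IsProbabilityMeasure ν] in
theorem measurable_g_apply (x : EuclideanSpace ℝ (Fin d)) : Measurable (g x) :=
  A.measurable_g.comp measurable_prodMk_left

theorem memLp_g {x : EuclideanSpace ℝ (Fin d)} (hx : x ∈ X) : MemLp (g x) 2 ν := by
  have hm := A.measurable_g_apply x
  have aux : ∀ {h : EuclideanSpace ℝ (Fin d)} {c : ℝ},
      ∫⁻ s, ENNReal.ofReal (‖g x s + h‖ ^ 2) ∂ν ≤ ENNReal.ofReal c → MemLp (g x) 2 ν := by
    intro h c hc
    have h1 := memLp_two_of_lintegral_sq_lt_top (ν := ν) (G := fun s => g x s + h)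
      (hm.add_const h).aestronglyMeasurable (hc.trans_lt ENNReal.ofReal_lt_top)
    have h2 := h1.sub (memLp_const h)
    refine h2.ae_eq (Eventually.of_forall fun s => ?_)
    simp
  rcases A.bound with ⟨L, L₀, _, _, hL, hL2⟩ | ⟨_, _, _, _, hb⟩ | ⟨_, _, _, _, hb⟩
  · refine aux (h := 0) ((lintegral_mono fun s => ?_).trans hL2)
    rw [add_zero]
    gcongr
    exact hL x hx s
  · obtain ⟨h, -, hh⟩ := hb x hx
    exact aux hh
  · obtain ⟨h, -, hh⟩ := hb x hx
    exact aux hh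

theorem meanGrad_mem {x : EuclideanSpace ℝ (Fin d)} (hx : x ∈ X) :
    meanGrad ν g x ∈ subdiff X ρ (fun y => ∫ s, f y s ∂ν) x :=
  integral_mem_subdiff A.integrable_ρξ A.integral_ρξ_le A.integrable_f hx
    ((A.memLp_g hx).integrable one_le_two) (A.g_mem x hx)

theorem proxData : ProxData X (ρ + η) lam (objective ν f r) where
  closed := A.closed
  lsc := (lowerSemicontinuousOn_of_subdiff_nonempty fun _ hx => ⟨_, A.meanGrad_mem hx⟩).add A.lsc_r
  weaklyConvex := ((WeaklyConvexOn.integral A.convex A.integrable_ρξ A.integrable_f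
    A.weaklyConvex_f).mono A.integral_ρξ_le).add A.weaklyConvex_r
  nonempty_optSet := A.nonempty_optSet
  lam_pos := A.lam_pos
  lam_mul_lt := by
    have h1 := A.lam_pos
    have h2 := A.η_nonneg
    have h3 := A.lam_mul_lt
    nlinarith

theorem measurable_meanGrad : Measurable (meanGrad ν g) :=
  (A.measurable_g.stronglyMeasurable.integral_prod_right' (f := Function.uncurry g)).measurable

theorem integral_norm_sub_meanGrad_sq_add_le {x h : EuclideanSpace ℝ (Fin d)} (hx : x ∈ X) {c : ℝ}
    (hc : 0 ≤ c) (hb : ∫⁻ s, ENNReal.ofReal (‖g x s + h‖ ^ 2) ∂ν ≤ ENNReal.ofReal c) :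
    ∫ s, ‖g x s - meanGrad ν g x‖ ^ 2 ∂ν ≤ c ∧ ‖meanGrad ν g x + h‖ ^ 2 ≤ c := by
  have h1 : ∫ s, ‖g x s + h‖ ^ 2 ∂ν ≤ c := by
    rw [integral_eq_lintegral_of_nonneg_ae (Eventually.of_forall fun s => sq_nonneg _)
      ((((A.measurable_g_apply x).add_const h).norm.pow_const 2).aestronglyMeasurable)]
    exact ENNReal.toReal_le_of_le_ofReal hc hb
  rw [integral_norm_add_sq (A.memLp_g hx) h] at h1
  have h2 : 0 ≤ ∫ s, ‖g x s - meanGrad ν g x‖ ^ 2 ∂ν :=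
    integral_nonneg fun s => sq_nonneg _
  have h3 := sq_nonneg ‖meanGrad ν g x + h‖
  unfold meanGrad at *
  constructor <;> linarith

/-- Under `BoundThree` or `BoundFour` the noise and the mean step `v + h` are both bounded by
an affine function of the value gap of the Moreau envelope. -/
theorem exists_bound_of_subdiff
    (hb : BoundThree X ν η lam f r g ∨ BoundFour X ν η lam f r g) :
    ∃ a b : ℝ, 0 ≤ a ∧ 0 ≤ b ∧ ∀ x ∈ X, ∃ h ∈ subdiff X η r x,
      ∫ s, ‖g x s - meanGrad ν g x‖ ^ 2 ∂ν ≤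
        a * (moreau X lam (objective ν f r) x - optVal X (objective ν f r)) + b ∧
      ‖meanGrad ν g x + h‖ ^ 2 ≤
        a * (moreau X lam (objective ν f r) x - optVal X (objective ν f r)) + b := by
  have hP := A.proxData
  have hl := A.lam_pos
  rcases hb with ⟨a, b, ha, hb, H⟩ | ⟨a, b, ha, hb, H⟩
  · refine ⟨a, b, ha, hb, fun x hx => ?_⟩
    obtain ⟨h, hh, hle⟩ := H x hx
    have hY := hP.moreau_sub_optVal_nonneg x
    exact ⟨h, hh, A.integral_norm_sub_meanGrad_sq_add_le hx (by positivity) hle⟩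
  · refine ⟨2 * a / lam, b, by positivity, hb, fun x hx => ?_⟩
    obtain ⟨h, hh, hle⟩ := H x hx
    have hY := hP.moreau_sub_optVal_nonneg x
    refine ⟨h, hh, A.integral_norm_sub_meanGrad_sq_add_le hx (by positivity)
      (hle.trans (ENNReal.ofReal_le_ofReal ?_))⟩
    have h1 := hP.norm_gradient_moreau_le x
    have h2 := hP.norm_prox_sub_sq_le x
    have h3 : ‖gradient (moreau X lam (objective ν f r)) x‖ ^ 2 ≤
        2 / lam * (moreau X lam (objective ν f r) x - optVal X (objective ν f r)) := by
      refine (pow_le_pow_left₀ (norm_nonneg _) h1 2).trans ?_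
      rw [div_pow, div_le_iff₀ (by positivity)]
      refine h2.trans (le_of_eq ?_)
      field_simp
    have h4 := mul_le_mul_of_nonneg_left h3 ha
    have e : 2 * a / lam * (moreau X lam (objective ν f r) x - optVal X (objective ν f r)) =
      a * (2 / lam * (moreau X lam (objective ν f r) x - optVal X (objective ν f r))) := by ring
    linarith

/-- Under `BoundDD` the noise and the mean subgradient are bounded, and the expectation is
Lipschitz. -/
theorem exists_bound_of_boundDD (hb : BoundDD X ν g) :
    ∃ L : ℝ, 0 ≤ L ∧ (∀ x ∈ X, ∫ s, ‖g x s - meanGrad ν g x‖ ^ 2 ∂ν ≤ L ^ 2) ∧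
      (∀ x ∈ X, ‖meanGrad ν g x‖ ≤ L) ∧
      ∀ x ∈ X, ∀ y ∈ X, (∫ s, f y s ∂ν) - ∫ s, f x s ∂ν ≤ L * ‖y - x‖ := by
  obtain ⟨L, L₀, _, hL₀, hL, hL2⟩ := hb
  have h1 : ∀ x ∈ X, ∫ s, ‖g x s - meanGrad ν g x‖ ^ 2 ∂ν ≤ L₀ ^ 2 ∧
      ‖meanGrad ν g x + 0‖ ^ 2 ≤ L₀ ^ 2 := fun x hx => by
    refine A.integral_norm_sub_meanGrad_sq_add_le hx (sq_nonneg _)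
      ((lintegral_mono fun s => ?_).trans hL2)
    rw [add_zero]
    gcongr
    exact hL x hx s
  have h2 : ∀ x ∈ X, ‖meanGrad ν g x‖ ≤ L₀ := fun x hx => by
    have := (h1 x hx).2
    rw [add_zero] at this
    exact le_of_sq_le_sq this hL₀
  exact ⟨L₀, hL₀, fun x hx => (h1 x hx).1, h2, fun x hx y hy =>
    sub_le_of_forall_exists_subgradient A.convex (F := fun y => ∫ s, f y s ∂ν) (ρ := ρ)
      (fun z hz => ⟨_, h2 z hz, mem_subdiff_iff.1 (A.meanGrad_mem hz)⟩) hx hy⟩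

end Assumptions

end Expected

/-! ### The drift of the value gap along a sample path -/

section Drift

variable {d : ℕ} {S : Type*} [MeasurableSpace S]

/-- The value gap `φ_lam(x) - φ*` of the Moreau envelope. -/
noncomputable def gap (X : Set (EuclideanSpace ℝ (Fin d))) (lam : ℝ)
    (φ : EuclideanSpace ℝ (Fin d) → ℝ) (x : EuclideanSpace ℝ (Fin d)) : ℝ :=
  moreau X lam φ x - optVal X φ

namespace Assumptions

variable {ν : Measure S} [IsProbabilityMeasure ν] {X : Set (EuclideanSpace ℝ (Fin d))}
  {f : EuclideanSpace ℝ (Fin d) → S → ℝ} {r : EuclideanSpace ℝ (Fin d) → ℝ}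
  {η ρ lam : ℝ} {ρξ : S → ℝ} {g : EuclideanSpace ℝ (Fin d) → S → EuclideanSpace ℝ (Fin d)}

/-- A pathwise bound on the value gap after one step with stepsize `α`: up to a term linear in the
noise, which has mean zero, and a term quadratic in the noise, it is at most `p` times the value
gap before the step. -/
def StepBound (A : Assumptions ν X f r η ρ lam ρξ g) (α p q w : ℝ) : Prop :=
  ∀ x ∈ X, ∀ s, ∀ z ∈ X,
    IsMinOn (fun y => ⟪g x s, y⟫ + r y + 1 / (2 * α) * ‖y - x‖ ^ 2) X z →
    gap X lam (objective ν f r) z ≤ p * gap X lam (objective ν f r) x +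
      q * ⟪g x s - meanGrad ν g x, A.proxData.prox x - x⟫ +
      w * (‖g x s - meanGrad ν g x‖ ^ 2 + 1)

variable (A : Assumptions ν X f r η ρ lam ρξ g)
include A

theorem gap_nonneg (x : EuclideanSpace ℝ (Fin d)) : 0 ≤ gap X lam (objective ν f r) x :=
  A.proxData.moreau_sub_optVal_nonneg x

theorem measurable_gap : Measurable (gap X lam (objective ν f r)) :=
  A.proxData.measurable_moreau.sub_const _

theorem norm_prox_sub_sq_le_gap (x : EuclideanSpace ℝ (Fin d)) :
    ‖A.proxData.prox x - x‖ ^ 2 ≤ 2 * lam * gap X lam (objective ν f r) x :=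
  A.proxData.norm_prox_sub_sq_le x

/-- The proximal point of `x` is a competitor in the proximal problem at `z`. -/
theorem gap_le_gap_add {z : EuclideanSpace ℝ (Fin d)} (x : EuclideanSpace ℝ (Fin d)) :
    gap X lam (objective ν f r) z ≤ gap X lam (objective ν f r) x +
      1 / (2 * lam) * (‖A.proxData.prox x - z‖ ^ 2 - ‖A.proxData.prox x - x‖ ^ 2) := by
  have h1 := A.proxData.moreau_le z (A.proxData.prox_mem x)
  have h2 := A.proxData.moreau_eq x
  unfold gap
  linarith

/-- All three growth conditions lead to the same estimates: the variance of the noise is at most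
an affine function of the value gap, a step with a small stepsize contracts the distance to the
proximal point, and a step with any admissible stepsize does not increase it too much. -/
theorem exists_dist_bound : ∃ a b α₀ : ℝ, 0 ≤ a ∧ 0 ≤ b ∧ 0 < α₀ ∧
    (∀ x ∈ X, ∫ s, ‖g x s - meanGrad ν g x‖ ^ 2 ∂ν ≤ a * gap X lam (objective ν f r) x + b) ∧
    (∀ α, 0 < α → α ≤ α₀ → ∃ q, ∀ x ∈ X, ∀ s, ∀ z ∈ X,
      IsMinOn (fun y => ⟪g x s, y⟫ + r y + 1 / (2 * α) * ‖y - x‖ ^ 2) X z →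
      ‖A.proxData.prox x - z‖ ^ 2 ≤
        (1 - α * (1 / lam - ρ - 2 * η)) * ‖A.proxData.prox x - x‖ ^ 2 +
        q * ⟪g x s - meanGrad ν g x, A.proxData.prox x - x⟫ +
        8 * α ^ 2 * (‖g x s - meanGrad ν g x‖ ^ 2 +
          (a * gap X lam (objective ν f r) x + b))) ∧
    (∀ α, 0 < α → α * η < 1 → ∃ c q w, 0 ≤ w ∧ ∀ x ∈ X, ∀ s, ∀ z ∈ X,
      IsMinOn (fun y => ⟪g x s, y⟫ + r y + 1 / (2 * α) * ‖y - x‖ ^ 2) X z →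
      ‖A.proxData.prox x - z‖ ^ 2 ≤ c * gap X lam (objective ν f r) x +
        q * ⟪g x s - meanGrad ν g x, A.proxData.prox x - x⟫ +
        w * (‖g x s - meanGrad ν g x‖ ^ 2 + 1)) := by
  have hl := A.lam_pos
  have hη := A.η_nonneg
  have hρ := A.ρ_nonneg
  have ht : 0 ≤ 1 / lam - ρ - 2 * η := by
    have : ρ + 2 * η ≤ 1 / lam := by rw [le_div_iff₀ hl, mul_comm]; exact A.lam_mul_lt.le
    linarith
  by_cases hb : BoundDD X ν g
  · obtain ⟨L, hL0, hLn, hLm, hL⟩ := A.exists_bound_of_boundDD hb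
    refine ⟨0, 4 * L ^ 2, lam / 2, le_rfl, by positivity, by positivity, fun x hx => ?_,
      fun α hα hα' => ⟨2 * α / (1 + α * (1 / lam - ρ - 2 * η)), fun x hx s z hz hmin => ?_⟩,
      fun α hα hαη => ?_⟩
    · have := hLn x hx
      have := sq_nonneg L
      linarith
    · have h1 := A.proxData.step_of_lipschitz A.weaklyConvex_r ht hη hρ hL hα hα' hx
        (A.meanGrad_mem hx) (hLm x hx) hz hmin
      rw [zero_mul, zero_add]
      refine h1.trans (add_le_add le_rfl ?_)
      refine mul_le_mul_of_nonneg_right ?_ (by positivity)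
      have := sq_nonneg α
      linarith
    · have hγ : 0 < 1 - α * η := by linarith
      refine ⟨((1 + α * ρ) * (2 * lam) + 2 * α) / (1 - α * η), 2 * α / (1 - α * η),
        2 * α ^ 2 * (1 + 4 * L ^ 2) / (1 - α * η), by positivity, fun x hx s z hz hmin => ?_⟩
      have h1 := A.proxData.step_crude_of_lipschitz A.weaklyConvex_r hL hα hx
        (A.meanGrad_mem hx) (hLm x hx) hz hmin
      have h2 := mul_le_mul_of_nonneg_left (A.norm_prox_sub_sq_le_gap x)
        (show 0 ≤ 1 + α * ρ by positivity)
      change _ ≤ _ + _ + 2 * α * gap X lam (objective ν f r) x + _ at h1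
      have hδ := sq_nonneg ‖g x s - meanGrad ν g x‖
      change (1 - α * η) * ‖A.proxData.prox x - z‖ ^ 2 ≤
        (1 + α * ρ) * ‖A.proxData.prox x - x‖ ^ 2 +
        2 * α * ⟪g x s - meanGrad ν g x, A.proxData.prox x - x⟫ + _ + _ at h1
      generalize A.proxData.prox x = p at *
      have h3 : 2 * α ^ 2 * (‖g x s - meanGrad ν g x‖ ^ 2 + 4 * L ^ 2) ≤
          2 * α ^ 2 * (1 + 4 * L ^ 2) * (‖g x s - meanGrad ν g x‖ ^ 2 + 1) := by
        rw [mul_assoc (2 * α ^ 2)]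
        refine mul_le_mul_of_nonneg_left ?_ (by positivity)
        have : 0 ≤ 4 * L ^ 2 * ‖g x s - meanGrad ν g x‖ ^ 2 := by positivity
        linarith
      refine le_of_mul_le_mul_left ?_ hγ
      calc _ ≤ ((1 + α * ρ) * (2 * lam) + 2 * α) * gap X lam (objective ν f r) x +
            2 * α * ⟪g x s - meanGrad ν g x, p - x⟫ +
            2 * α ^ 2 * (1 + 4 * L ^ 2) * (‖g x s - meanGrad ν g x‖ ^ 2 + 1) := by linarith
        _ = _ := by field_simp
  · obtain ⟨a, b, ha, hb', H⟩ := A.exists_bound_of_subdiff (A.bound.resolve_left hb)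
    have hstep : ∀ α, 0 < α → α * η < 1 → ∀ x ∈ X, ∀ s, ∀ z ∈ X,
        IsMinOn (fun y => ⟪g x s, y⟫ + r y + 1 / (2 * α) * ‖y - x‖ ^ 2) X z →
        ‖A.proxData.prox x - z‖ ^ 2 ≤
          (1 - α * (1 / lam - ρ - 2 * η)) * ‖A.proxData.prox x - x‖ ^ 2 +
          2 * α / (1 - α * η) * ⟪g x s - meanGrad ν g x, A.proxData.prox x - x⟫ +
          2 * α ^ 2 / (1 - α * η) ^ 2 * (‖g x s - meanGrad ν g x‖ ^ 2 +
            (a * gap X lam (objective ν f r) x + b)) := by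
      intro α hα hαη x hx s z hz hmin
      obtain ⟨h, hh, -, hB⟩ := H x hx
      exact A.proxData.step_of_subdiff A.weaklyConvex_r hη ht hα hαη hx (A.meanGrad_mem hx) hh hB
        hz hmin
    refine ⟨a, b, 1 / (2 * (η + 1)), ha, hb', by positivity, fun x hx => ?_,
      fun α hα hα' => ?_, fun α hα hαη => ?_⟩
    · obtain ⟨h, -, h1, -⟩ := H x hx
      exact h1
    · have hαη : α * η ≤ 1 / 2 := by
        rw [le_div_iff₀ (by positivity)] at hα'
        linarith
      refine ⟨_, fun x hx s z hz hmin =>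
        (hstep α hα (by linarith) x hx s z hz hmin).trans (add_le_add le_rfl ?_)⟩
      have hY := A.gap_nonneg x
      refine mul_le_mul_of_nonneg_right ?_ (by positivity)
      rw [div_le_iff₀ (by nlinarith)]
      have h1 : (1 / 2 : ℝ) ^ 2 ≤ (1 - α * η) ^ 2 :=
        pow_le_pow_left₀ (by norm_num) (by linarith) 2
      have := mul_le_mul_of_nonneg_left h1 (sq_nonneg α)
      linarith
    · have hγ : 0 < 1 - α * η := by linarith
      set w := 2 * α ^ 2 / (1 - α * η) ^ 2 with hw
      have hw0 : 0 ≤ w := by positivity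
      refine ⟨2 * lam + w * a, 2 * α / (1 - α * η), w * (1 + b), by positivity,
        fun x hx s z hz hmin => ?_⟩
      have h1 := hstep α hα hαη x hx s z hz hmin
      have h2 := A.norm_prox_sub_sq_le_gap x
      have h3 : (1 - α * (1 / lam - ρ - 2 * η)) * ‖A.proxData.prox x - x‖ ^ 2 ≤
          1 * ‖A.proxData.prox x - x‖ ^ 2 := by
        refine mul_le_mul_of_nonneg_right ?_ (sq_nonneg _)
        have : 0 ≤ α * (1 / lam - ρ - 2 * η) := by positivity
        linarith
      have h4 : 0 ≤ w * b * ‖g x s - meanGrad ν g x‖ ^ 2 := by positivity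
      linarith

/-- The drift of the value gap: under the KL property it contracts by the factor `1 - α * m` up
to `O(α²)`, and for any admissible stepsize it stays under control. -/
theorem exists_stepBound {κ : ℝ} (hκ : 0 < κ) (hKL : GlobalKL X (ρ + η) (objective ν f r) κ) :
    ∃ a b C α₀ : ℝ, 0 ≤ a ∧ 0 ≤ b ∧ 0 ≤ C ∧ 0 < α₀ ∧
    (∀ x ∈ X, ∫ s, ‖g x s - meanGrad ν g x‖ ^ 2 ∂ν ≤ a * gap X lam (objective ν f r) x + b) ∧
    (∀ α, 0 < α → α ≤ α₀ → ∃ q, A.StepBound α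
      (1 - α * ((1 - lam * (ρ + 2 * η)) / (2 * (κ + lam / 2))) + C * α ^ 2) q (C * α ^ 2)) ∧
    (∀ α, 0 < α → α * η < 1 → ∃ p q w, 0 ≤ w ∧ A.StepBound α p q w) := by
  have hl := A.lam_pos
  obtain ⟨a, b, α₀, ha, hb, hα₀, hnoise, hfine, hcrude⟩ := A.exists_dist_bound
  have ht : 0 ≤ 1 / lam - ρ - 2 * η := by
    have : ρ + 2 * η ≤ 1 / lam := by rw [le_div_iff₀ hl, mul_comm]; exact A.lam_mul_lt.le
    linarith
  refine ⟨a, b, 4 / lam * (1 + a + b), α₀, ha, hb, by positivity, hα₀, hnoise,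
    fun α hα hα' => ?_, fun α hα hαη => ?_⟩
  · obtain ⟨q, hq⟩ := hfine α hα hα'
    refine ⟨1 / (2 * lam) * q, fun x hx s z hz hmin => ?_⟩
    have h1 := hq x hx s z hz hmin
    have h2 := A.gap_le_gap_add (z := z) x
    have h3 := A.proxData.moreau_sub_optVal_le_of_globalKL x hκ hKL
    have hY := A.gap_nonneg x
    change gap X lam (objective ν f r) x ≤ _ at h3
    generalize A.proxData.prox x = p at *
    generalize gap X lam (objective ν f r) x = Y at *
    generalize ⟪g x s - meanGrad ν g x, p - x⟫ = I at *
    have hδ := sq_nonneg ‖g x s - meanGrad ν g x‖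
    generalize ‖g x s - meanGrad ν g x‖ ^ 2 = N at *
    have h4 : 1 / (2 * lam) * (‖p - z‖ ^ 2 - ‖p - x‖ ^ 2) ≤
        1 / (2 * lam) * (-(α * (1 / lam - ρ - 2 * η)) * ‖p - x‖ ^ 2 + q * I +
          8 * α ^ 2 * (N + (a * Y + b))) :=
      mul_le_mul_of_nonneg_left (by linarith) (by positivity)
    have h5 := mul_le_mul_of_nonneg_left h3
      (show 0 ≤ α * ((1 - lam * (ρ + 2 * η)) / (2 * (κ + lam / 2))) by
        have := A.lam_mul_lt
        have : 0 ≤ 1 - lam * (ρ + 2 * η) := by linarith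
        positivity)
    have e1 : α * ((1 - lam * (ρ + 2 * η)) / (2 * (κ + lam / 2))) *
        ((κ + lam / 2) / lam ^ 2 * ‖p - x‖ ^ 2) =
        1 / (2 * lam) * (α * (1 / lam - ρ - 2 * η)) * ‖p - x‖ ^ 2 := by
      have : κ + lam / 2 ≠ 0 := by positivity
      generalize κ + lam / 2 = k at *
      field_simp
      ring
    have e2 : 1 / (2 * lam) * (8 * α ^ 2 * (N + (a * Y + b))) =
        4 / lam * α ^ 2 * (N + (a * Y + b)) := by
      field_simp; ring
    have h6 : 4 / lam * α ^ 2 * (N + (a * Y + b)) ≤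
        4 / lam * α ^ 2 * ((1 + a + b) * Y + (1 + a + b) * (N + 1)) := by
      refine mul_le_mul_of_nonneg_left ?_ (by positivity)
      have : 0 ≤ a * N := by positivity
      have : 0 ≤ b * N := by positivity
      have : 0 ≤ b * Y := by positivity
      linarith
    linarith
  · obtain ⟨c, q, w, hw, hq⟩ := hcrude α hα hαη
    refine ⟨1 + 1 / (2 * lam) * c, 1 / (2 * lam) * q, 1 / (2 * lam) * w, by positivity,
      fun x hx s z hz hmin => ?_⟩
    have h1 := hq x hx s z hz hmin
    have h2 := A.gap_le_gap_add (z := z) x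
    have h4 : 1 / (2 * lam) * (‖A.proxData.prox x - z‖ ^ 2 - ‖A.proxData.prox x - x‖ ^ 2) ≤
        1 / (2 * lam) * (c * gap X lam (objective ν f r) x +
          q * ⟪g x s - meanGrad ν g x, A.proxData.prox x - x⟫ +
          w * (‖g x s - meanGrad ν g x‖ ^ 2 + 1)) :=
      mul_le_mul_of_nonneg_left (by have := sq_nonneg ‖A.proxData.prox x - x‖; linarith)
        (by positivity)
    linarith

end Assumptions

end Drift

/-! ### Sequences and processes with a contracting drift -/

section Recursion

/-- If `y (k + 1) ≤ (1 - m α k) y k + C (α k)²` with `∑ α = ∞` and `∑ α² < ∞`, then `y` cannot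
stay away from `0`, since `∑ α k y k` is finite. -/
theorem exists_lt_of_drift {α y : ℕ → ℝ} {m C : ℝ} (hm : 0 < m) (hC : 0 ≤ C)
    (hα : ∀ k, 0 < α k) (hαsum : ¬ Summable α) (hαsq : Summable fun k => α k ^ 2)
    (hy : ∀ k, 0 ≤ y k) (hstep : ∀ k, y (k + 1) ≤ (1 - m * α k) * y k + C * α k ^ 2)
    {ε : ℝ} (hε : 0 < ε) : ∃ᶠ k in atTop, y k < ε := by
  intro hcon
  obtain ⟨N, hN⟩ := eventually_atTop.1 hcon
  refine hαsum ((summable_nat_add_iff N).1 ?_)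
  have hb : ∀ n, y (n + N) + m * ε * ∑ i ∈ Finset.range n, α (i + N) ≤
      y N + C * ∑ i ∈ Finset.range n, α (i + N) ^ 2 := by
    intro n
    induction n with
    | zero => simp
    | succ n ih =>
      rw [Finset.sum_range_succ, Finset.sum_range_succ]
      have h1 := hstep (n + N)
      have h2 : ε ≤ y (n + N) := not_lt.1 (hN (n + N) (Nat.le_add_left _ _))
      have h3 := mul_le_mul_of_nonneg_left h2 (mul_pos hm (hα (n + N))).le
      rw [show n + N + 1 = n + 1 + N by ring] at h1
      linarith
  refine summable_of_sum_range_le (c := (y N + C * ∑' i, α (i + N) ^ 2) / (m * ε))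
    (fun i => (hα _).le) fun n => ?_
  rw [le_div_iff₀ (by positivity)]
  have h1 : ∑ i ∈ Finset.range n, α (i + N) ^ 2 ≤ ∑' i, α (i + N) ^ 2 :=
    ((summable_nat_add_iff N).2 hαsq).sum_le_tsum _ fun i _ => sq_nonneg _
  have h2 := mul_le_mul_of_nonneg_left h1 hC
  have := hb n
  have := hy (n + N)
  linarith

/-- Chung's lemma: `y (k + 1) ≤ (1 - a / k) y k + C / k²` with `a > 1` gives `y k = O(1 / k)`. -/
theorem exists_le_div_of_drift {y : ℕ → ℝ} {a C : ℝ} (ha : 1 < a) {K : ℕ}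
    (hstep : ∀ k, K ≤ k → y (k + 1) ≤ (1 - a / k) * y k + C / k ^ 2) :
    ∃ M : ℝ, ∀ k : ℕ, 1 ≤ k → y k ≤ M / k := by
  obtain ⟨K', hK'⟩ := exists_nat_ge a
  set N := max (max K K') 1 with hN
  have hNK : K ≤ N := (le_max_left _ _).trans (le_max_left _ _)
  have hNK' : K' ≤ N := (le_max_right _ _).trans (le_max_left _ _)
  have hN1 : 1 ≤ N := le_max_right _ _
  -- the first values are absorbed into the constant
  set M := max (C / (a - 1)) (∑ k ∈ Finset.range (N + 1), |k * y k|) with hM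
  have hsmall : ∀ k : ℕ, 1 ≤ k → k ≤ N → y k ≤ M / k := by
    intro k hk hkN
    have hk0 : (0 : ℝ) < k := by exact_mod_cast hk
    rw [le_div_iff₀ hk0, mul_comm]
    refine (le_abs_self _).trans ((Finset.single_le_sum (f := fun k : ℕ => |k * y k|)
      (fun i _ => abs_nonneg _) (Finset.mem_range.2 (Nat.lt_succ_of_le hkN))).trans
      (le_max_right _ _))
  refine ⟨M, fun k hk => ?_⟩
  rcases le_total k N with h | h
  · exact hsmall k hk h
  · induction k, h using Nat.le_induction with
    | base => exact hsmall N hN1 le_rfl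
    | succ k hNk ih =>
      have hk1 : 1 ≤ k := hN1.trans hNk
      have hk0 : (0 : ℝ) < k := by exact_mod_cast hk1
      have hak : a ≤ k := hK'.trans (by exact_mod_cast hNK'.trans hNk)
      have h1 := hstep k (hNK.trans hNk)
      have h2 : (1 - a / k) * y k ≤ (1 - a / k) * (M / k) :=
        mul_le_mul_of_nonneg_left (ih hk1) (by
          rw [sub_nonneg, div_le_one hk0]; exact hak)
      refine (h1.trans (add_le_add_left h2 _)).trans ?_
      have hMC : C ≤ (a - 1) * M := by
        have := le_max_left (C / (a - 1)) (∑ k ∈ Finset.range (N + 1), |k * y k|)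
        rw [← hM, div_le_iff₀ (by linarith)] at this
        linarith
      have hM0 : 0 ≤ M := (Finset.sum_nonneg fun i _ => abs_nonneg _).trans (le_max_right _ _)
      have e : (1 - a / k) * (M / k) + C / k ^ 2 = (M * k - a * M + C) / k ^ 2 := by
        field_simp
      push_cast
      rw [e, div_le_div_iff₀ (by positivity) (by positivity)]
      nlinarith

variable {Ω : Type*} {mΩ : MeasurableSpace Ω} {P : Measure Ω} [IsProbabilityMeasure P]

/-- A nonnegative adapted process with a contracting drift tends to `0` almost surely. The drift
is expressed through its integral against bounded weights known at time `k`. The initial value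
need not be integrable: weighting by `1 / (1 + Y 0)` makes it so. The weighted process plus the
tail of `∑ C α²` is then a nonnegative supermartingale. -/
theorem ae_tendsto_zero_of_drift {ℱ : Filtration ℕ mΩ} {Y : ℕ → Ω → ℝ} (hY : ∀ k ω, 0 ≤ Y k ω)
    (hadp : ∀ k, Measurable[ℱ k] (Y k)) {α : ℕ → ℝ} {m C : ℝ} (hm : 0 < m) (hC : 0 ≤ C)
    (hα : ∀ k, 0 < α k) (hαsum : ¬ Summable α) (hαsq : Summable fun k => α k ^ 2)
    (hstep : ∀ k (W : Ω → ℝ), Measurable[ℱ k] W → (∀ ω, 0 ≤ W ω) → (∀ ω, W ω ≤ 1) →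
      Integrable (fun ω => W ω * Y k ω) P → Integrable (fun ω => W ω * Y (k + 1) ω) P ∧
      ∫ ω, W ω * Y (k + 1) ω ∂P ≤
        (1 - m * α k) * ∫ ω, W ω * Y k ω ∂P + C * α k ^ 2 * ∫ ω, W ω ∂P) :
    ∀ᵐ ω ∂P, Tendsto (fun k => Y k ω) atTop (𝓝 0) := by
  set w : Ω → ℝ := fun ω => 1 / (1 + Y 0 ω) with hw
  have hwpos : ∀ ω, 0 < w ω := fun ω => by have := hY 0 ω; positivity
  have hw1 : ∀ ω, w ω ≤ 1 := fun ω => by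
    have := hY 0 ω
    rw [hw, div_le_one (by positivity)]
    linarith
  have hwm : ∀ k, Measurable[ℱ k] w := fun k =>
    ((measurable_const.add (hadp 0)).const_div 1).mono (ℱ.mono (Nat.zero_le k)) le_rfl
  have hint : ∀ k, Integrable (fun ω => w ω * Y k ω) P := by
    intro k
    induction k with
    | zero =>
      refine Integrable.of_bound (C := 1) ((((hwm 0).mul (hadp 0)).mono (ℱ.le 0) le_rfl
        ).aestronglyMeasurable) (Eventually.of_forall fun ω => ?_)
      have := hY 0 ω
      rw [Real.norm_of_nonneg (mul_nonneg (hwpos ω).le this), hw, one_div_mul_eq_div,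
        div_le_one (by positivity)]
      linarith
    | succ k ih => exact (hstep k w (hwm k) (fun ω => (hwpos ω).le) hw1 ih).1
  set T : ℕ → ℝ := fun k => ∑' i, C * α (i + k) ^ 2 with hT
  have hsum : Summable fun k => C * α k ^ 2 := hαsq.mul_left C
  have hTs : ∀ k, T k = C * α k ^ 2 + T (k + 1) := fun k => by
    have := ((summable_nat_add_iff k).2 hsum).tsum_eq_zero_add
    simp only [hT]
    rw [this, zero_add]
    congr 2
    ext i
    rw [show i + 1 + k = i + (k + 1) by ring]
  have hT0 : ∀ k, 0 ≤ T k := fun k => tsum_nonneg fun i => by positivity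
  have hTlim : Tendsto T atTop (𝓝 0) := tendsto_sum_nat_add fun k => C * α k ^ 2
  set V : ℕ → Ω → ℝ := fun k ω => w ω * Y k ω + T k with hV
  have hVint : ∀ k, Integrable (V k) P := fun k => (hint k).add (integrable_const _)
  have hV0 : ∀ k ω, 0 ≤ V k ω := fun k ω =>
    add_nonneg (mul_nonneg (hwpos ω).le (hY k ω)) (hT0 k)
  have hsub : Submartingale (fun k ω => -V k ω) ℱ P := by
    refine submartingale_of_setIntegral_le_succ (fun k => Measurable.stronglyMeasurable
      ((((hwm k).mul (hadp k)).add_const _).neg)) (fun k => (hVint k).neg) fun k s hs => ?_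
    rw [integral_neg, integral_neg, neg_le_neg_iff]
    have hs' := ℱ.le k s hs
    have hind : ∀ (j : ℕ), (fun ω => s.indicator w ω * Y j ω) =
        s.indicator (fun ω => w ω * Y j ω) := fun j => by
      ext ω
      by_cases h : ω ∈ s <;> simp [h]
    obtain ⟨h1, h2⟩ := hstep k (s.indicator w) ((hwm k).indicator hs)
      (fun ω => Set.indicator_nonneg (fun ω _ => (hwpos ω).le) ω)
      (fun ω => (Set.indicator_le_self' (fun ω _ => (hwpos ω).le) ω).trans (hw1 ω))
      (by rw [hind]; exact (hint k).indicator hs')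
    rw [hind, hind, integral_indicator hs', integral_indicator hs', integral_indicator hs'] at h2
    have h3 : 0 ≤ ∫ ω in s, w ω * Y k ω ∂P :=
      integral_nonneg fun ω => mul_nonneg (hwpos ω).le (hY k ω)
    have h4 : ∫ ω in s, w ω ∂P ≤ P.real s := by
      have : ∫ ω in s, w ω ∂P ≤ ∫ ω in s, (1 : ℝ) ∂P := by
        refine integral_mono_of_nonneg (Eventually.of_forall fun ω => (hwpos ω).le)
          (integrable_const _) (Eventually.of_forall hw1)
      simpa using this
    have e : ∀ j, ∫ ω in s, V j ω ∂P = (∫ ω in s, w ω * Y j ω ∂P) + P.real s * T j := fun j => by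
      simp only [hV]
      rw [integral_add (hint j).integrableOn (integrable_const _), integral_const]
      simp
    rw [e, e, hTs k]
    have h5 := mul_le_mul_of_nonneg_left h4 (show 0 ≤ C * α k ^ 2 by positivity)
    have h6 : 0 ≤ m * α k * ∫ ω in s, w ω * Y k ω ∂P :=
      mul_nonneg (mul_pos hm (hα k)).le h3
    linarith
  have hVmono : ∀ k, ∫ ω, V k ω ∂P ≤ ∫ ω, V 0 ω ∂P := fun k => by
    have := hsub.setIntegral_le (Nat.zero_le k) (s := Set.univ) MeasurableSet.univ
    simpa [integral_neg] using this
  have hbdd : ∀ k, eLpNorm (fun ω => -V k ω) 1 P ≤ (Real.toNNReal (∫ ω, V 0 ω ∂P) : ℝ≥0∞) := by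
    intro k
    rw [eLpNorm_one_eq_lintegral_enorm]
    have : ∀ ω, ‖-V k ω‖ₑ = ENNReal.ofReal (V k ω) := fun ω => by
      rw [enorm_neg, Real.enorm_eq_ofReal (hV0 k ω)]
    simp_rw [this]
    rw [← ofReal_integral_eq_lintegral_ofReal (hVint k) (Eventually.of_forall (hV0 k))]
    exact ENNReal.ofReal_le_ofReal (hVmono k)
  obtain ⟨l, hlmeas, hconv⟩ := measurable_limit_of_tendsto_metrizable_ae
    (fun k => (hVint k).neg.aemeasurable) (hsub.exists_ae_tendsto_of_bdd hbdd)
  have hconv' : ∀ᵐ ω ∂P, Tendsto (fun k => w ω * Y k ω) atTop (𝓝 (-l ω)) := by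
    filter_upwards [hconv] with ω hω
    have := hω.neg.sub hTlim
    simpa [hV] using this
  -- the means come arbitrarily close to `0`, so Fatou's lemma makes the limit vanish
  have hfreq : ∀ ε : ℝ, 0 < ε → ∃ᶠ k in atTop, ∫ ω, w ω * Y k ω ∂P < ε := fun ε hε =>
    exists_lt_of_drift hm hC hα hαsum hαsq
      (fun k => integral_nonneg fun ω => mul_nonneg (hwpos ω).le (hY k ω))
      (fun k => by
        have h1 := (hstep k w (hwm k) (fun ω => (hwpos ω).le) hw1 (hint k)).2
        have h2 : ∫ ω, w ω ∂P ≤ 1 := by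
          have : ∫ ω, w ω ∂P ≤ ∫ ω, (1 : ℝ) ∂P :=
            integral_mono_of_nonneg (Eventually.of_forall fun ω => (hwpos ω).le)
              (integrable_const _) (Eventually.of_forall hw1)
          simpa using this
        have h3 := mul_le_mul_of_nonneg_left h2 (show 0 ≤ C * α k ^ 2 by positivity)
        linarith) hε
  have hzero : ∫⁻ ω, ENNReal.ofReal (-l ω) ∂P = 0 := by
    refine le_antisymm (ENNReal.le_of_forall_pos_le_add fun ε hε _ => ?_) bot_le
    rw [zero_add]
    calc ∫⁻ ω, ENNReal.ofReal (-l ω) ∂P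
        = ∫⁻ ω, liminf (fun k => ENNReal.ofReal (w ω * Y k ω)) atTop ∂P := by
          refine lintegral_congr_ae ?_
          filter_upwards [hconv'] with ω hω
          exact ((ENNReal.continuous_ofReal.tendsto _).comp hω).liminf_eq.symm
      _ ≤ liminf (fun k => ∫⁻ ω, ENNReal.ofReal (w ω * Y k ω) ∂P) atTop :=
          lintegral_liminf_le fun k =>
            (((hwm k).mul (hadp k)).mono (ℱ.le k) le_rfl).ennreal_ofReal
      _ ≤ ε := by
          refine liminf_le_of_frequently_le' ((hfreq ε (by exact_mod_cast hε)).mono fun k hk => ?_)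
          rw [← ofReal_integral_eq_lintegral_ofReal (hint k)
            (Eventually.of_forall fun ω => mul_nonneg (hwpos ω).le (hY k ω))]
          exact ENNReal.ofReal_le_of_le_toReal hk.le
  have hlm : AEMeasurable (fun ω => ENNReal.ofReal (-l ω)) P :=
    hlmeas.neg.ennreal_ofReal.aemeasurable
  rw [lintegral_eq_zero_iff' hlm] at hzero
  filter_upwards [hzero, hconv'] with ω h1 h2
  have h3 : 0 ≤ -l ω := ge_of_tendsto' h2 fun k => mul_nonneg (hwpos ω).le (hY k ω)
  have h4 : -l ω = 0 := le_antisymm (ENNReal.ofReal_eq_zero.1 h1) h3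
  rw [h4] at h2
  have h5 := h2.const_mul (w ω)⁻¹
  rw [mul_zero] at h5
  refine h5.congr fun k => ?_
  rw [inv_mul_cancel_left₀ (hwpos ω).ne']

end Recursion

/-! ### One step of the method in expectation -/

section Samples

variable {Ω : Type*} {m mΩ : MeasurableSpace Ω} {P : Measure Ω} [IsProbabilityMeasure P]
  {S : Type*} [MeasurableSpace S] {ν : Measure S}

/-- The information contained in the samples `ξ 0, …, ξ (k - 1)`. -/
def past (ξ : ℕ → Ω → S) (hξ : ∀ k, Measurable (ξ k)) : Filtration ℕ mΩ where
  seq k := ⨆ j : Fin k, MeasurableSpace.comap (ξ j) inferInstance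
  mono' _ _ hij := iSup_le fun j => le_iSup_of_le (Fin.castLE hij j) le_rfl
  le' _ := iSup_le fun j => (hξ j).comap_le

omit [IsProbabilityMeasure P] in
theorem indep_past {ξ : ℕ → Ω → S} (hξ : ∀ k, Measurable (ξ k)) (hind : iIndepFun ξ P) (k : ℕ) :
    Indep (past ξ hξ k) (MeasurableSpace.comap (ξ k) inferInstance) P := by
  have h := indep_iSup_of_disjoint (fun i => (hξ i).comap_le) hind
    (S := {j | j < k}) (T := {k}) (by simp)
  refine indep_of_indep_of_le_left (indep_of_indep_of_le_right h ?_) ?_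
  · exact le_iSup₂_of_le k rfl le_rfl
  · exact iSup_le fun j => le_iSup₂_of_le (j : ℕ) j.2 le_rfl

variable {T : Type*} [MeasurableSpace T]

/-- A random variable known in advance and a fresh sample have the product of their laws as
joint law. -/
theorem map_prodMk_eq_prod (hm : m ≤ mΩ) {ζ : Ω → S} (hζ : Measurable ζ) (hlaw : P.map ζ = ν)
    (hind : Indep m (MeasurableSpace.comap ζ inferInstance) P) {Z : Ω → T} (hZ : Measurable[m] Z) :
    P.map (fun ω => (Z ω, ζ ω)) = (P.map Z).prod ν := by
  have hi : IndepFun Z ζ P := indep_of_indep_of_le_left hind hZ.comap_le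
  rw [← hlaw]
  exact (indepFun_iff_map_prod_eq_prod_map_map (hZ.mono hm le_rfl).aemeasurable
    hζ.aemeasurable).1 hi

/-- Averaging over a fresh sample with the known variable frozen. -/
theorem lintegral_comp_prodMk [SFinite ν] (hm : m ≤ mΩ) {ζ : Ω → S} (hζ : Measurable ζ)
    (hlaw : P.map ζ = ν) (hind : Indep m (MeasurableSpace.comap ζ inferInstance) P) {Z : Ω → T}
    (hZ : Measurable[m] Z) {H : T × S → ℝ≥0∞} (hH : Measurable H) :
    ∫⁻ ω, H (Z ω, ζ ω) ∂P = ∫⁻ ω, ∫⁻ s, H (Z ω, s) ∂ν ∂P := by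
  have hZ' : Measurable Z := hZ.mono hm le_rfl
  rw [← lintegral_map hH (hZ'.prodMk hζ), map_prodMk_eq_prod hm hζ hlaw hind hZ,
    lintegral_prod _ hH.aemeasurable, lintegral_map hH.lintegral_prod_right' hZ']

theorem integral_comp_prodMk [SFinite ν] (hm : m ≤ mΩ) {ζ : Ω → S} (hζ : Measurable ζ)
    (hlaw : P.map ζ = ν) (hind : Indep m (MeasurableSpace.comap ζ inferInstance) P) {Z : Ω → T}
    (hZ : Measurable[m] Z) {H : T × S → ℝ} (hH : Measurable H)
    (hint : Integrable (fun ω => H (Z ω, ζ ω)) P) :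
    ∫ ω, H (Z ω, ζ ω) ∂P = ∫ ω, ∫ s, H (Z ω, s) ∂ν ∂P := by
  have hZ' : Measurable Z := hZ.mono hm le_rfl
  have h1 := map_prodMk_eq_prod hm hζ hlaw hind hZ
  have h2 : Integrable H ((P.map Z).prod ν) := by
    rw [← h1]
    exact (integrable_map_measure hH.aestronglyMeasurable (hZ'.prodMk hζ).aemeasurable).2 hint
  rw [← integral_map (hZ'.prodMk hζ).aemeasurable hH.aestronglyMeasurable, h1,
    integral_prod _ h2, integral_map hZ'.aemeasurable
      hH.stronglyMeasurable.integral_prod_right'.aestronglyMeasurable]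

end Samples

namespace Assumptions

variable {d : ℕ} {S : Type*} [MeasurableSpace S]
  {ν : Measure S} [IsProbabilityMeasure ν] {X : Set (EuclideanSpace ℝ (Fin d))}
  {f : EuclideanSpace ℝ (Fin d) → S → ℝ} {r : EuclideanSpace ℝ (Fin d) → ℝ}
  {η ρ lam : ℝ} {ρξ : S → ℝ} {g : EuclideanSpace ℝ (Fin d) → S → EuclideanSpace ℝ (Fin d)}
  (A : Assumptions ν X f r η ρ lam ρξ g)
  {Ω : Type*} {m mΩ : MeasurableSpace Ω} {P : Measure Ω} [IsProbabilityMeasure P]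
include A

/-- Taking expectations in a pathwise bound, against a weight known before the sample is drawn:
the linear term in the noise disappears and the quadratic term is bounded by the variance. -/
theorem StepBound.integral_le {α p q w a b : ℝ} (hw : 0 ≤ w) (ha : 0 ≤ a) (hb : 0 ≤ b)
    (hstep : A.StepBound α p q w)
    (hnoise : ∀ x ∈ X, ∫ s, ‖g x s - meanGrad ν g x‖ ^ 2 ∂ν ≤
      a * gap X lam (objective ν f r) x + b)
    (hm : m ≤ mΩ) {ζ : Ω → S} (hζ : Measurable ζ) (hlaw : P.map ζ = ν)
    (hind : Indep m (MeasurableSpace.comap ζ inferInstance) P)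
    {x x' : Ω → EuclideanSpace ℝ (Fin d)} (hx : Measurable[m] x) (hxX : ∀ ω, x ω ∈ X)
    (hx' : Measurable x') (hx'X : ∀ ω, x' ω ∈ X)
    (hmin : ∀ ω, IsMinOn (fun y => ⟪g (x ω) (ζ ω), y⟫ + r y + 1 / (2 * α) * ‖y - x ω‖ ^ 2) X (x' ω))
    {W : Ω → ℝ} (hW : Measurable[m] W) (hW0 : ∀ ω, 0 ≤ W ω) (hW1 : ∀ ω, W ω ≤ 1)
    (hint : Integrable (fun ω => W ω * gap X lam (objective ν f r) (x ω)) P) :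
    Integrable (fun ω => W ω * gap X lam (objective ν f r) (x' ω)) P ∧
    ∫ ω, W ω * gap X lam (objective ν f r) (x' ω) ∂P ≤
      (p + w * a) * ∫ ω, W ω * gap X lam (objective ν f r) (x ω) ∂P +
        w * (b + 1) * ∫ ω, W ω ∂P := by
  have hl := A.lam_pos
  have hWm : Measurable W := hW.mono hm le_rfl
  have hxm : Measurable x := hx.mono hm le_rfl
  have hZ : Measurable[m] fun ω => (x ω, W ω) := hx.prodMk hW
  have hgm := A.measurable_g
  have hvm := A.measurable_meanGrad
  have hpm := A.proxData.continuous_prox.measurable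
  have hδm : Measurable fun t : (EuclideanSpace ℝ (Fin d) × ℝ) × S =>
      g t.1.1 t.2 - meanGrad ν g t.1.1 :=
    (hgm.comp (measurable_fst.fst.prodMk measurable_snd)).sub (hvm.comp measurable_fst.fst)
  have hWint : Integrable W P := Integrable.of_bound hWm.aestronglyMeasurable (C := 1)
    (Eventually.of_forall fun ω => by rw [Real.norm_of_nonneg (hW0 ω)]; exact hW1 ω)
  set δ : Ω → EuclideanSpace ℝ (Fin d) := fun ω => g (x ω) (ζ ω) - meanGrad ν g (x ω) with hδ
  have hδΩ : Measurable δ := hδm.comp (((hxm.prodMk hWm)).prodMk hζ)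
  set u : Ω → EuclideanSpace ℝ (Fin d) := fun ω => A.proxData.prox (x ω) - x ω with hu
  have hum : Measurable u := (hpm.comp hxm).sub hxm
  set Y : Ω → ℝ := fun ω => gap X lam (objective ν f r) (x ω) with hY
  have hY0 : ∀ ω, 0 ≤ Y ω := fun ω => A.gap_nonneg _
  have hbint : Integrable (fun ω => a * (W ω * Y ω) + b * W ω) P :=
    (hint.const_mul a).add (hWint.const_mul b)
  have hb0 : ∀ ω, 0 ≤ a * (W ω * Y ω) + b * W ω := fun ω => by
    have := hW0 ω; have := hY0 ω; positivity
  -- the quadratic term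
  have hN : ∫⁻ ω, ENNReal.ofReal (W ω * ‖δ ω‖ ^ 2) ∂P ≤
      ∫⁻ ω, ENNReal.ofReal (a * (W ω * Y ω) + b * W ω) ∂P := by
    rw [lintegral_comp_prodMk (ν := ν) hm hζ hlaw hind hZ
      (H := fun t => ENNReal.ofReal (t.1.2 * ‖g t.1.1 t.2 - meanGrad ν g t.1.1‖ ^ 2))
      ((measurable_fst.snd.mul (hδm.norm.pow_const 2)).ennreal_ofReal)]
    refine lintegral_mono fun ω => ?_
    dsimp only
    have hML : MemLp (fun s => g (x ω) s - meanGrad ν g (x ω)) 2 ν :=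
      (A.memLp_g (hxX ω)).sub (memLp_const _)
    rw [← ofReal_integral_eq_lintegral_ofReal
      (((memLp_two_iff_integrable_sq_norm hML.1).1 hML).const_mul (W ω))
      (Eventually.of_forall fun s => mul_nonneg (hW0 ω) (sq_nonneg _)), integral_const_mul]
    refine ENNReal.ofReal_le_ofReal ?_
    have := mul_le_mul_of_nonneg_left (hnoise (x ω) (hxX ω)) (hW0 ω)
    simp only [hY]
    linarith
  have hNint : Integrable (fun ω => W ω * ‖δ ω‖ ^ 2) P := by
    refine ⟨(hWm.mul (hδΩ.norm.pow_const 2)).aestronglyMeasurable, ?_⟩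
    rw [hasFiniteIntegral_iff_ofReal
      (Eventually.of_forall fun ω => mul_nonneg (hW0 ω) (sq_nonneg _))]
    refine hN.trans_lt ?_
    rw [← hasFiniteIntegral_iff_ofReal (Eventually.of_forall hb0)]
    exact hbint.2
  have hNle : ∫ ω, W ω * ‖δ ω‖ ^ 2 ∂P ≤ a * ∫ ω, W ω * Y ω ∂P + b * ∫ ω, W ω ∂P := by
    rw [← integral_const_mul, ← integral_const_mul,
      ← integral_add (hint.const_mul a) (hWint.const_mul b)]
    rw [← ofReal_integral_eq_lintegral_ofReal hNint
      (Eventually.of_forall fun ω => mul_nonneg (hW0 ω) (sq_nonneg _)),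
      ← ofReal_integral_eq_lintegral_ofReal hbint (Eventually.of_forall hb0)] at hN
    exact (ENNReal.ofReal_le_ofReal_iff (integral_nonneg hb0)).1 hN
  -- the linear term
  have hIint : Integrable (fun ω => W ω * ⟪δ ω, u ω⟫) P := by
    refine (hNint.add (hint.const_mul (2 * lam))).mono'
      (hWm.mul (hδΩ.inner hum)).aestronglyMeasurable (Eventually.of_forall fun ω => ?_)
    rw [norm_mul, Real.norm_of_nonneg (hW0 ω), Real.norm_eq_abs, Pi.add_apply]
    have h1 := abs_real_inner_le_norm (δ ω) (u ω)
    have h2 : ‖u ω‖ ^ 2 ≤ 2 * lam * Y ω := A.norm_prox_sub_sq_le_gap (x ω)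
    have h3 : |⟪δ ω, u ω⟫| ≤ ‖δ ω‖ ^ 2 + 2 * lam * Y ω := by
      nlinarith [sq_nonneg (‖δ ω‖ - ‖u ω‖), sq_nonneg ‖δ ω‖, sq_nonneg ‖u ω‖]
    have := mul_le_mul_of_nonneg_left h3 (hW0 ω)
    simp only [hY] at *
    linarith
  have hI0 : ∫ ω, W ω * ⟪δ ω, u ω⟫ ∂P = 0 := by
    have h := integral_comp_prodMk (ν := ν) hm hζ hlaw hind hZ
      (H := fun t => t.1.2 * ⟪g t.1.1 t.2 - meanGrad ν g t.1.1,
        A.proxData.prox t.1.1 - t.1.1⟫)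
      (measurable_fst.snd.mul (hδm.inner ((hpm.comp measurable_fst.fst).sub measurable_fst.fst)))
      hIint
    dsimp only at h
    refine h.trans ?_
    refine integral_eq_zero_of_ae (Eventually.of_forall fun ω => ?_)
    have hgi := (A.memLp_g (hxX ω)).integrable one_le_two
    have hi : Integrable (fun s => g (x ω) s - meanGrad ν g (x ω)) ν :=
      hgi.sub (integrable_const _)
    dsimp only
    simp_rw [real_inner_comm (A.proxData.prox (x ω) - x ω)]
    rw [integral_const_mul, integral_inner hi, integral_sub hgi (integrable_const _),
      integral_const]
    simp [meanGrad]
  have hpt : ∀ ω, W ω * gap X lam (objective ν f r) (x' ω) ≤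
      p * (W ω * Y ω) + q * (W ω * ⟪δ ω, u ω⟫) + w * (W ω * ‖δ ω‖ ^ 2 + W ω) := fun ω => by
    have := mul_le_mul_of_nonneg_left (hstep (x ω) (hxX ω) (ζ ω) (x' ω) (hx'X ω) (hmin ω)) (hW0 ω)
    simp only [hδ, hu, hY]
    linarith
  have hi1 : Integrable (fun ω => p * (W ω * Y ω) + q * (W ω * ⟪δ ω, u ω⟫)) P :=
    (hint.const_mul p).add (hIint.const_mul q)
  have hi2 : Integrable (fun ω => w * (W ω * ‖δ ω‖ ^ 2 + W ω)) P :=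
    (hNint.add hWint).const_mul w
  have hint' : Integrable (fun ω => W ω * gap X lam (objective ν f r) (x' ω)) P := by
    refine (hi1.add hi2).mono' (hWm.mul (A.measurable_gap.comp hx')).aestronglyMeasurable
      (Eventually.of_forall fun ω => ?_)
    rw [Real.norm_of_nonneg (mul_nonneg (hW0 ω) (A.gap_nonneg _))]
    exact hpt ω
  refine ⟨hint', (integral_mono hint' (hi1.add hi2) hpt).trans ?_⟩
  have e : ∫ ω, (p * (W ω * Y ω) + q * (W ω * ⟪δ ω, u ω⟫) + w * (W ω * ‖δ ω‖ ^ 2 + W ω)) ∂P =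
      p * ∫ ω, W ω * Y ω ∂P + w * (∫ ω, W ω * ‖δ ω‖ ^ 2 ∂P + ∫ ω, W ω ∂P) := by
    rw [integral_add hi1 hi2, integral_add (hint.const_mul p) (hIint.const_mul q),
      integral_const_mul, integral_const_mul, integral_const_mul, hI0,
      integral_add hNint hWint]
    ring
  refine e.le.trans ?_
  have := mul_le_mul_of_nonneg_left hNle hw
  linarith

end Assumptions

/-! ### Convergence of the iterates -/

namespace Assumptions

variable {d : ℕ} {S : Type*} [MeasurableSpace S]
  {ν : Measure S} [IsProbabilityMeasure ν] {X : Set (EuclideanSpace ℝ (Fin d))}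
  {f : EuclideanSpace ℝ (Fin d) → S → ℝ} {r : EuclideanSpace ℝ (Fin d) → ℝ}
  {η ρ lam : ℝ} {ρξ : S → ℝ} {g : EuclideanSpace ℝ (Fin d) → S → EuclideanSpace ℝ (Fin d)}
  (A : Assumptions ν X f r η ρ lam ρξ g)
  {Ω : Type*} {mΩ : MeasurableSpace Ω} {P : Measure Ω} [IsProbabilityMeasure P]
  {ξ : ℕ → Ω → S} {α : ℕ → ℝ} {x₀ : EuclideanSpace ℝ (Fin d)}
  {x : ℕ → Ω → EuclideanSpace ℝ (Fin d)}

omit [IsProbabilityMeasure ν] in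
theorem _root_.StoSubGrad.IsStoSubGrad.mem (hx : IsStoSubGrad X r g ξ α x₀ x) (hx₀ : x₀ ∈ X)
    (k : ℕ) (ω : Ω) : x k ω ∈ X := by
  cases k with
  | zero => rw [hx.1]; exact hx₀
  | succ k => exact (hx.2.2 k ω).1

include A

/-- `StepBound.integral_le` for the iterates of the method. -/
theorem integral_gap_succ_le (hξ : ∀ k, Measurable (ξ k)) (hlaw : ∀ k, P.map (ξ k) = ν)
    (hind : iIndepFun ξ P) (hx : IsStoSubGrad X r g ξ α x₀ x) (hx₀ : x₀ ∈ X)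
    {a b : ℝ} (ha : 0 ≤ a) (hb : 0 ≤ b)
    (hnoise : ∀ x ∈ X, ∫ s, ‖g x s - meanGrad ν g x‖ ^ 2 ∂ν ≤
      a * gap X lam (objective ν f r) x + b)
    (k : ℕ) {p q w : ℝ} (hw : 0 ≤ w) (hstep : A.StepBound (α k) p q w)
    {W : Ω → ℝ} (hW : Measurable[past ξ hξ k] W) (hW0 : ∀ ω, 0 ≤ W ω) (hW1 : ∀ ω, W ω ≤ 1)
    (hint : Integrable (fun ω => W ω * gap X lam (objective ν f r) (x k ω)) P) :
    Integrable (fun ω => W ω * gap X lam (objective ν f r) (x (k + 1) ω)) P ∧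
    ∫ ω, W ω * gap X lam (objective ν f r) (x (k + 1) ω) ∂P ≤
      (p + w * a) * ∫ ω, W ω * gap X lam (objective ν f r) (x k ω) ∂P +
        w * (b + 1) * ∫ ω, W ω ∂P :=
  StepBound.integral_le A hw ha hb hstep hnoise ((past ξ hξ).le k) (hξ k) (hlaw k)
    (indep_past hξ hind k) (hx.2.1 k) (hx.mem hx₀ k)
    ((hx.2.1 (k + 1)).mono ((past ξ hξ).le (k + 1)) le_rfl) (hx.mem hx₀ (k + 1))
    (fun ω => (hx.2.2 k ω).2) hW hW0 hW1 hint

/-- Once the stepsizes are small, half of the contraction absorbs the terms of order `α²`. -/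
theorem eventually_integral_gap_succ_le (hξ : ∀ k, Measurable (ξ k))
    (hlaw : ∀ k, P.map (ξ k) = ν)
    (hind : iIndepFun ξ P) (hx : IsStoSubGrad X r g ξ α x₀ x) (hx₀ : x₀ ∈ X)
    {κ : ℝ} (hκ : 0 < κ) (hKL : GlobalKL X (ρ + η) (objective ν f r) κ)
    (hα : ∀ k, 0 < α k) (hαlim : Tendsto α atTop (𝓝 0)) :
    ∃ C : ℝ, 0 ≤ C ∧ ∃ K : ℕ, ∀ k, K ≤ k → ∀ W : Ω → ℝ, Measurable[past ξ hξ k] W →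
      (∀ ω, 0 ≤ W ω) → (∀ ω, W ω ≤ 1) →
      Integrable (fun ω => W ω * gap X lam (objective ν f r) (x k ω)) P →
      Integrable (fun ω => W ω * gap X lam (objective ν f r) (x (k + 1) ω)) P ∧
      ∫ ω, W ω * gap X lam (objective ν f r) (x (k + 1) ω) ∂P ≤
        (1 - (1 - lam * (ρ + 2 * η)) / (4 * (κ + lam / 2)) * α k) *
          ∫ ω, W ω * gap X lam (objective ν f r) (x k ω) ∂P + C * α k ^ 2 * ∫ ω, W ω ∂P := by
  have hl := A.lam_pos
  obtain ⟨a, b, C, α₀, ha, hb, hC, hα₀, hnoise, hfine, -⟩ := A.exists_stepBound hκ hKL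
  set m := (1 - lam * (ρ + 2 * η)) / (4 * (κ + lam / 2)) with hm
  have hmpos : 0 < m := by
    have := A.lam_mul_lt
    have : 0 < 1 - lam * (ρ + 2 * η) := by linarith
    positivity
  have hm2 : (1 - lam * (ρ + 2 * η)) / (2 * (κ + lam / 2)) = 2 * m := by
    rw [hm]
    have : κ + lam / 2 ≠ 0 := by positivity
    generalize κ + lam / 2 = k at *
    field_simp
    ring
  have hev : ∀ᶠ k in atTop, α k < min α₀ (m / (C * (1 + a) + 1)) :=
    hαlim.eventually (gt_mem_nhds (lt_min hα₀ (by positivity)))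
  obtain ⟨K, hK⟩ := eventually_atTop.1 hev
  refine ⟨C * (b + 1), by positivity, K, fun k hk W hW hW0 hW1 hint => ?_⟩
  have hk' := hK k hk
  obtain ⟨q, hq⟩ := hfine (α k) (hα k) (hk'.le.trans (min_le_left _ _))
  obtain ⟨h1, h2⟩ := A.integral_gap_succ_le hξ hlaw hind hx hx₀ ha hb hnoise k
    (by positivity) hq hW hW0 hW1 hint
  refine ⟨h1, h2.trans ?_⟩
  have h3 : α k * (C * (1 + a)) ≤ m := by
    have h4 := hk'.le.trans (min_le_right _ _)
    rw [le_div_iff₀ (by positivity)] at h4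
    have := (hα k).le
    linarith
  have h5 := mul_le_mul_of_nonneg_left h3 (hα k).le
  have h6 : 0 ≤ ∫ ω, W ω * gap X lam (objective ν f r) (x k ω) ∂P :=
    integral_nonneg fun ω => mul_nonneg (hW0 ω) (A.gap_nonneg _)
  rw [hm2]
  refine add_le_add (mul_le_mul_of_nonneg_right ?_ h6) (le_of_eq (by ring))
  linarith

theorem ae_tendsto_gap (hξ : ∀ k, Measurable (ξ k)) (hlaw : ∀ k, P.map (ξ k) = ν)
    (hind : iIndepFun ξ P) (hx : IsStoSubGrad X r g ξ α x₀ x) (hx₀ : x₀ ∈ X)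
    {κ : ℝ} (hκ : 0 < κ) (hKL : GlobalKL X (ρ + η) (objective ν f r) κ)
    (hα : ∀ k, 0 < α k) (hαsum : ¬ Summable α) (hαsq : Summable fun k => α k ^ 2)
    (hαlim : Tendsto α atTop (𝓝 0)) :
    ∀ᵐ ω ∂P, Tendsto (fun k => gap X lam (objective ν f r) (x k ω)) atTop (𝓝 0) := by
  have hl := A.lam_pos
  obtain ⟨C, hC, K, hK⟩ :=
    A.eventually_integral_gap_succ_le hξ hlaw hind hx hx₀ hκ hKL hα hαlim
  -- the iterates from time `K` on, with their filtration
  set ℱ : Filtration ℕ mΩ :=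
    { seq := fun k => past ξ hξ (k + K)
      mono' := fun i j hij => (past ξ hξ).mono (Nat.add_le_add_right hij K)
      le' := fun k => (past ξ hξ).le (k + K) } with hℱ
  have hmain := ae_tendsto_zero_of_drift (P := P) (ℱ := ℱ)
    (Y := fun k ω => gap X lam (objective ν f r) (x (k + K) ω)) (α := fun k => α (k + K))
    (m := (1 - lam * (ρ + 2 * η)) / (4 * (κ + lam / 2))) (C := C)
    (fun k ω => A.gap_nonneg _) (fun k => A.measurable_gap.comp (hx.2.1 (k + K)))
    (by
      have := A.lam_mul_lt
      have : 0 < 1 - lam * (ρ + 2 * η) := by linarith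
      positivity)
    hC (fun k => hα _) (fun h => hαsum ((summable_nat_add_iff K).1 h))
    ((summable_nat_add_iff K).2 hαsq)
    (fun k W hW hW0 hW1 hint => by
      have := hK (k + K) (Nat.le_add_left _ _) W hW hW0 hW1 hint
      rwa [show k + K + 1 = k + 1 + K by ring] at this)
  filter_upwards [hmain] with ω hω
  exact (tendsto_add_atTop_iff_nat K).1 hω

theorem integrable_gap (hξ : ∀ k, Measurable (ξ k)) (hlaw : ∀ k, P.map (ξ k) = ν)
    (hind : iIndepFun ξ P) (hx : IsStoSubGrad X r g ξ α x₀ x) (hx₀ : x₀ ∈ X)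
    {κ : ℝ} (hκ : 0 < κ) (hKL : GlobalKL X (ρ + η) (objective ν f r) κ)
    (hα : ∀ k, 0 < α k) (hαη : ∀ k, α k * η < 1) (k : ℕ) :
    Integrable (fun ω => gap X lam (objective ν f r) (x k ω)) P := by
  obtain ⟨a, b, -, -, ha, hb, -, -, hnoise, -, hcrude⟩ := A.exists_stepBound hκ hKL
  induction k with
  | zero => simp only [hx.1]; exact integrable_const _
  | succ k ih =>
    obtain ⟨p, q, w, hw, hstep⟩ := hcrude (α k) (hα k) (hαη k)
    have := (A.integral_gap_succ_le hξ hlaw hind hx hx₀ ha hb hnoise k hw hstep (W := fun _ => 1)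
      measurable_const (fun _ => zero_le_one) (fun _ => le_rfl) (by simpa using ih)).1
    simpa using this

theorem exists_integral_gap_le_div (hξ : ∀ k, Measurable (ξ k)) (hlaw : ∀ k, P.map (ξ k) = ν)
    (hind : iIndepFun ξ P) (hx : IsStoSubGrad X r g ξ α x₀ x) (hx₀ : x₀ ∈ X)
    {κ : ℝ} (hκ : 0 < κ) (hKL : GlobalKL X (ρ + η) (objective ν f r) κ)
    (hα : ∀ k, 0 < α k) (hαη : ∀ k, α k * η < 1) (hαlim : Tendsto α atTop (𝓝 0))
    {Δ : ℝ} (hΔ : 4 * (κ + lam / 2) / (1 - lam * (ρ + 2 * η)) < Δ)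
    (hαΔ : ∀ᶠ k : ℕ in atTop, α k = Δ / k) :
    ∃ C : ℝ, ∀ k : ℕ, 1 ≤ k → ∫ ω, gap X lam (objective ν f r) (x k ω) ∂P ≤ C / k := by
  have hl := A.lam_pos
  obtain ⟨C, hC, K, hK⟩ :=
    A.eventually_integral_gap_succ_le hξ hlaw hind hx hx₀ hκ hKL hα hαlim
  obtain ⟨K', hK'⟩ := eventually_atTop.1 hαΔ
  have hpos : 0 < 1 - lam * (ρ + 2 * η) := by have := A.lam_mul_lt; linarith
  have ha : 1 < (1 - lam * (ρ + 2 * η)) / (4 * (κ + lam / 2)) * Δ := by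
    rw [div_lt_iff₀ hpos] at hΔ
    rw [div_mul_eq_mul_div, one_lt_div (by positivity)]
    linarith
  refine exists_le_div_of_drift ha (C := C * Δ ^ 2) (K := max K K') fun k hk => ?_
  have h1 := (hK k ((le_max_left _ _).trans hk) (fun _ => 1) measurable_const
    (fun _ => zero_le_one) (fun _ => le_rfl)
    (by simpa using A.integrable_gap hξ hlaw hind hx hx₀ hκ hKL hα hαη k)).2
  rw [hK' k ((le_max_right _ _).trans hk)] at h1
  simp only [one_mul, integral_const, probReal_univ, smul_eq_mul, mul_one] at h1
  refine h1.trans (le_of_eq ?_)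
  rw [div_pow, mul_div_assoc, mul_div_assoc]

end Assumptions

end StoSubGrad

theorem mainTheorem6
    -- the problem `min_{x ∈ X} φ(x) = 𝔼[f(x, ξ)] + r(x)`
    {d : ℕ} {S : Type*} [MeasurableSpace S] (ν : Measure S) [IsProbabilityMeasure ν]
    (X : Set (EuclideanSpace ℝ (Fin d))) (hXclosed : IsClosed X) (hXconvex : Convex ℝ X)
    (f : EuclideanSpace ℝ (Fin d) → S → ℝ) (r : EuclideanSpace ℝ (Fin d) → ℝ)
    (hfint : ∀ x ∈ X, Integrable (f x) ν)
    (hflsc : ∀ s, LowerSemicontinuousOn (fun x => f x s) X)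
    (hrlsc : LowerSemicontinuousOn r X)
    -- weak convexity
    (η ρ : ℝ) (hη : 0 ≤ η) (ρξ : S → ℝ) (hρint : Integrable ρξ ν)
    (hρ0 : 0 ≤ ∫ s, ρξ s ∂ν) (hρ : ∫ s, ρξ s ∂ν ≤ ρ)
    (hr : StoSubGrad.WeaklyConvexOn X η r)
    (hf : ∀ s, StoSubGrad.WeaklyConvexOn X (ρξ s) (fun x => f x s))
    (hopt : (StoSubGrad.optSet X (StoSubGrad.objective ν f r)).Nonempty)
    -- the stochastic subgradients and their upper bounds
    (g : EuclideanSpace ℝ (Fin d) → S → EuclideanSpace ℝ (Fin d))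
    (hgmeas : Measurable (Function.uncurry g))
    (hg : ∀ x ∈ X, ∀ s, g x s ∈ StoSubGrad.subdiff X (ρξ s) (fun y => f y s) x)
    (lam : ℝ) (hlam0 : 0 < lam) (hlam : lam * (ρ + 2 * η) < 1)
    (hbound : StoSubGrad.BoundDD X ν g ∨ StoSubGrad.BoundThree X ν η lam f r g ∨
      StoSubGrad.BoundFour X ν η lam f r g)
    -- the stepsizes
    (α : ℕ → ℝ) (hα : ∀ k, 0 < α k)
    (hαsum : Tendsto (fun n => ∑ k ∈ Finset.range n, α k) atTop atTop)
    (hαsq : Summable (fun k => α k ^ 2))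
    -- the samples and the iterates
    {Ω : Type*} [MeasurableSpace Ω] (P : Measure Ω) [IsProbabilityMeasure P]
    (ξ : ℕ → Ω → S) (hξmeas : ∀ k, Measurable (ξ k)) (hξlaw : ∀ k, P.map (ξ k) = ν)
    (hξindep : iIndepFun ξ P)
    (x₀ : EuclideanSpace ℝ (Fin d)) (hx₀ : x₀ ∈ X)
    (x : ℕ → Ω → EuclideanSpace ℝ (Fin d))
    (hx : StoSubGrad.IsStoSubGrad X r g ξ α x₀ x)
    -- the global KL property with exponent `1/2`
    (κ : ℝ) (hκ : 0 < κ)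
    (hKL : StoSubGrad.GlobalKL X (ρ + η) (StoSubGrad.objective ν f r) κ) :
    (∀ᵐ ω ∂P, Tendsto (fun k => StoSubGrad.moreau X lam (StoSubGrad.objective ν f r) (x k ω))
      atTop (𝓝 (StoSubGrad.optVal X (StoSubGrad.objective ν f r)))) ∧
    (∀ Δ : ℝ, 4 * (κ + lam / 2) / (1 - lam * (ρ + 2 * η)) < Δ →
      (∀ᶠ k : ℕ in atTop, α k = Δ / k) → (∀ k, α k * η < 1) →
      (∀ k, Integrable (fun ω => StoSubGrad.moreau X lam (StoSubGrad.objective ν f r) (x k ω) -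
        StoSubGrad.optVal X (StoSubGrad.objective ν f r)) P) ∧
      ∃ C : ℝ, ∀ k : ℕ, 1 ≤ k →
        ∫ ω, (StoSubGrad.moreau X lam (StoSubGrad.objective ν f r) (x k ω) -
          StoSubGrad.optVal X (StoSubGrad.objective ν f r)) ∂P ≤ C / k) := by
  have A : StoSubGrad.Assumptions ν X f r η ρ lam ρξ g :=
    ⟨hXclosed, hXconvex, hfint, hrlsc, hη, hρint, hρ0, hρ, hr, hf, hopt, hgmeas, hg, hlam0, hlam,
      hbound⟩
  have hαns : ¬ Summable α := (not_summable_iff_tendsto_nat_atTop_of_nonneg fun k => (hα k).le).2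
    hαsum
  have hαlim : Tendsto α atTop (𝓝 0) := by
    have h := (hαsq.tendsto_atTop_zero).sqrt
    rw [Real.sqrt_zero] at h
    exact h.congr fun k => Real.sqrt_sq (hα k).le
  refine ⟨?_, fun Δ hΔ hαΔ hαη => ⟨?_, ?_⟩⟩
  · filter_upwards [A.ae_tendsto_gap hξmeas hξlaw hξindep hx hx₀ hκ hKL hα hαns hαsq hαlim]
      with ω hω
    exact tendsto_sub_nhds_zero_iff.1 hω
  · exact A.integrable_gap hξmeas hξlaw hξindep hx hx₀ hκ hKL hα hαη
  · exact A.exists_integral_gap_le_div hξmeas hξlaw hξindep hx hx₀ hκ hKL hα hαη hαlim hΔ hαΔ
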